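/- Let $M$ be a smooth manifold of dimension $2n$ with $n>2$, and let $(g,J)$ be a smooth almost Hermitian structure on $M$: $g$ is a Riemannian metric and $J$ an endomorphism field of $TM$ with $J^2=-\mathrm{id}$ and $g(Jx,Jy)=g(x,y)$. Let $\nabla$ be the Levi-Civita connection of $g$, let $R(x,y)=[\nabla_x,\nabla_y]-\nabla_{[x,y]}$ and $R(x,y,z,u)=g(R(x,y)z,u)$ be its curvature tensor, $\rho(y,z)=\operatorname{trace}(x\mapsto R(x,y)z)$ the Ricci tensor and $\tau$ its trace with respect to $g$, the scalar curvature. Put $$Q=\frac{1}{2(n+2)}\,\rho-\frac{\tau}{8(n+1)(n+2)}\,g ,$$ $$\begin{aligned}\varphi(Q)(x,y,z,u)={}& g(x,u)Q(y,z)-g(x,z)Q(y,u)+g(y,z)Q(x,u)-g(y,u)Q(x,z)\\&+g(x,Ju)Q(y,Jz)-g(x,Jz)Q(y,Ju)-2g(x,Jy)Q(z,Ju)\\&+g(y,Jz)Q(x,Ju)-g(y,Ju)Q(x,Jz)-2g(z,Ju)Q(x,Jy),\end{aligned}$$ and call $B=R-\varphi(Q)$ the classical Bochner curvature tensor. **Theorem.**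 Suppose that $B=0$ on $M$. If $M$ is not Kähler at a point $p\in M$, that is, if $\nabla J\neq 0$ at $p$, then $M$ is flat in a neighbourhood of $p$: there is an open set $U\ni p$ such that $R=0$ at every point of $U$. -/

import Mathlib

set_option maxSynthPendingDepth 3

open Bundle
open scoped Manifold ContDiff

/-!
Local Riemannian geometry. `G : E → E →L[ℝ] E →L[ℝ] ℝ` is a field of bilinear forms and
`K : E → E →L[ℝ] E` a field of endomorphisms on (an open subset of) a finite-dimensional real
vector space `E`; they are the expressions of a metric and of an almost complex structure in a
coordinate chart. Vectors `x z w u : E` are regarded as constant (coordinate) vector fields.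
-/
namespace LocalGeometry

noncomputable section

variable {E : Type*} [NormedAddCommGroup E] [NormedSpace ℝ E]

/-- The Levi-Civita connection form `Γ` of `G` at `y`, given by the Koszul formula
`2 G (Γ x z) w = (D_x G) z w + (D_z G) x w - (D_w G) x z`, so that `∇_x z = Γ x z` for constant
vector fields `x`, `z`. -/
def christoffel (G : E → E →L[ℝ] E →L[ℝ] ℝ) (y : E) : E →L[ℝ] E →L[ℝ] E :=
  (1 / 2 : ℝ) • (ContinuousLinearMap.compL ℝ E (E →L[ℝ] ℝ) E (G y).inverse ∘L
    (fderiv ℝ G y + (fderiv ℝ G y).flip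
      - ((ContinuousLinearMap.flipₗᵢ ℝ E E ℝ).toContinuousLinearEquiv :
          (E →L[ℝ] E →L[ℝ] ℝ) →L[ℝ] (E →L[ℝ] E →L[ℝ] ℝ)) ∘L (fderiv ℝ G y).flip))

/-- The Koszul formula, written out with the inverse of the metric. -/
theorem christoffel_apply (G : E → E →L[ℝ] E →L[ℝ] ℝ) (y x z : E) :
    christoffel G y x z = (1 / 2 : ℝ) • (G y).inverse
      (fderiv ℝ G y x z + fderiv ℝ G y z x - ((fderiv ℝ G y).flip x).flip z) := rfl

/-- The curvature operator `R(x, z) w = ∇_x ∇_z w - ∇_z ∇_x w` at `y`, for constant vector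
fields `x z w`. -/
def curvature (G : E → E →L[ℝ] E →L[ℝ] ℝ) (y x z w : E) : E :=
  fderiv ℝ (christoffel G) y x z w - fderiv ℝ (christoffel G) y z x w
    + christoffel G y x (christoffel G y z w) - christoffel G y z (christoffel G y x w)

/-- The curvature tensor `R(x, z, w, u) = g(R(x, z) w, u)`. -/
def curvatureTensor (G : E → E →L[ℝ] E →L[ℝ] ℝ) (y x z w u : E) : ℝ :=
  G y (curvature G y x z w) u

/-- The endomorphism `x ↦ R(x, z) w`. -/
def curvatureEndo (G : E → E →L[ℝ] E →L[ℝ] ℝ) (y z w : E) : E →ₗ[ℝ] E where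
  toFun x := curvature G y x z w
  map_add' a b := by simp [curvature]; abel
  map_smul' c a := by simp [curvature, smul_sub, smul_add]

/-- The Ricci tensor `ρ(z, w) = trace (x ↦ R(x, z) w)`. -/
def ricci (G : E → E →L[ℝ] E →L[ℝ] ℝ) (y : E) : E →ₗ[ℝ] E →ₗ[ℝ] ℝ :=
  LinearMap.mk₂ ℝ (fun z w => LinearMap.trace ℝ E (curvatureEndo G y z w))
    (fun z z' w => by
      rw [← map_add]; congr 1; ext x; simp [curvatureEndo, curvature]; abel)
    (fun c z w => by
      rw [← map_smul]; congr 1; ext x; simp [curvatureEndo, curvature, smul_sub, smul_add])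
    (fun z w w' => by
      rw [← map_add]; congr 1; ext x; simp [curvatureEndo, curvature]; abel)
    (fun c z w => by
      rw [← map_smul]; congr 1; ext x; simp [curvatureEndo, curvature, smul_sub, smul_add])

/-- The scalar curvature `τ`: the trace of the endomorphism `A` with `g(A x, z) = ρ(x, z)`. -/
def scalarCurvature [FiniteDimensional ℝ E] (G : E → E →L[ℝ] E →L[ℝ] ℝ) (y : E) : ℝ :=
  LinearMap.trace ℝ E
    (((G y).inverse : (E →L[ℝ] ℝ) →ₗ[ℝ] E) ∘ₗ
      ((LinearMap.toContinuousLinearMap : (E →ₗ[ℝ] ℝ) ≃ₗ[ℝ] (E →L[ℝ] ℝ)) :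
        (E →ₗ[ℝ] ℝ) →ₗ[ℝ] (E →L[ℝ] ℝ)) ∘ₗ ricci G y)

/-- The tensor `Q = ρ / (2 (n + 2)) - τ g / (8 (n + 1) (n + 2))`, in real dimension `2 n`. -/
def tensorQ [FiniteDimensional ℝ E] (n : ℕ) (G : E → E →L[ℝ] E →L[ℝ] ℝ) (y x z : E) : ℝ :=
  1 / (2 * ((n : ℝ) + 2)) * ricci G y x z
    - scalarCurvature G y / (8 * ((n : ℝ) + 1) * ((n : ℝ) + 2)) * G y x z

/-- The algebraic operator `φ`, for a bilinear form `g`, an endomorphism `J` and a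
function `Q` of two vectors. -/
def phi (g : E →L[ℝ] E →L[ℝ] ℝ) (J : E →L[ℝ] E) (Q : E → E → ℝ) (x y z u : E) : ℝ :=
  g x u * Q y z - g x z * Q y u
    + g y z * Q x u - g y u * Q x z
    + g x (J u) * Q y (J z) - g x (J z) * Q y (J u) - 2 * g x (J y) * Q z (J u)
    + g y (J z) * Q x (J u) - g y (J u) * Q x (J z) - 2 * g z (J u) * Q x (J y)

/-- The classical Bochner curvature tensor `B = R - φ(Q)`. -/
def bochnerTensor [FiniteDimensional ℝ E] (n : ℕ) (G : E → E →L[ℝ] E →L[ℝ] ℝ)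
    (K : E → E →L[ℝ] E) (y x z w u : E) : ℝ :=
  curvatureTensor G y x z w u - phi (G y) (K y) (tensorQ n G y) x z w u

/-- The covariant derivative `(∇_x K) z = ∇_x (K z) - K (∇_x z)`, for constant vector
fields `x z`. -/
def nablaEndo (G : E → E →L[ℝ] E →L[ℝ] ℝ) (K : E → E →L[ℝ] E) (y x z : E) : E :=
  fderiv ℝ K y x z + christoffel G y x (K y z) - K y (christoffel G y x z)

end

end LocalGeometry

/-- A (smooth) almost Hermitian structure `(g, J)` on a smooth manifold `M` modelled on `E`. -/
structure AlmostHermitian (E : Type*) [NormedAddCommGroup E] [NormedSpace ℝ E]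
    (M : Type*) [TopologicalSpace M] [ChartedSpace E M] [IsManifold 𝓘(ℝ, E) ∞ M] where
  /-- The Riemannian metric `g`. -/
  metric : ContMDiffRiemannianMetric 𝓘(ℝ, E) ∞ E (fun p : M => TangentSpace 𝓘(ℝ, E) p)
  /-- The almost complex structure `J`. -/
  J : ∀ p : M, TangentSpace 𝓘(ℝ, E) p →L[ℝ] TangentSpace 𝓘(ℝ, E) p
  J_contMDiff : ContMDiff 𝓘(ℝ, E) (𝓘(ℝ, E).prod 𝓘(ℝ, E →L[ℝ] E)) ∞
    (fun p : M => TotalSpace.mk' (E →L[ℝ] E)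
      (E := fun p : M => TangentSpace 𝓘(ℝ, E) p →L[ℝ] TangentSpace 𝓘(ℝ, E) p) p (J p))
  J_sq : ∀ (p : M) (v : TangentSpace 𝓘(ℝ, E) p), J p (J p v) = -v
  metric_J : ∀ (p : M) (v w : TangentSpace 𝓘(ℝ, E) p),
    metric.inner p (J p v) (J p w) = metric.inner p v w

namespace AlmostHermitian

noncomputable section

open LocalGeometry

variable {E : Type*} [NormedAddCommGroup E] [NormedSpace ℝ E]
  {M : Type*} [TopologicalSpace M] [ChartedSpace E M] [IsManifold 𝓘(ℝ, E) ∞ M]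

/-- The metric in the chart `e`, at the coordinate point `y`: the pullback of `g` by `e⁻¹`. -/
def metricIn (A : AlmostHermitian E M) (e : OpenPartialHomeomorph M E) (y : E) :
    E →L[ℝ] E →L[ℝ] ℝ :=
  let g : E →L[ℝ] E →L[ℝ] ℝ := A.metric.inner (e.symm y)
  let D : E →L[ℝ] E := mfderiv 𝓘(ℝ, E) 𝓘(ℝ, E) e.symm y
  g.bilinearComp D D

/-- The almost complex structure in the chart `e`, at the coordinate point `y`:
`de ∘ J ∘ d(e⁻¹)`. -/
def JIn (A : AlmostHermitian E M) (e : OpenPartialHomeomorph M E) (y : E) : E →L[ℝ] E :=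
  (mfderiv 𝓘(ℝ, E) 𝓘(ℝ, E) e (e.symm y)) ∘L (A.J (e.symm y)) ∘L
    (mfderiv 𝓘(ℝ, E) 𝓘(ℝ, E) e.symm y)

/-- The classical Bochner tensor of `M` (of dimension `2 n`) vanishes identically: its
components vanish in every smooth chart. -/
def BochnerVanishes [FiniteDimensional ℝ E] (n : ℕ) (A : AlmostHermitian E M) : Prop :=
  ∀ e ∈ IsManifold.maximalAtlas 𝓘(ℝ, E) ∞ M, ∀ y ∈ e.target, ∀ x z w u : E,
    bochnerTensor n (A.metricIn e) (A.JIn e) y x z w u = 0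

/-- `M` is Kähler at `p`: `∇J = 0` at `p`, i.e. the components of `∇J` at `p` vanish in every
smooth chart around `p`. -/
def IsKahlerAt (A : AlmostHermitian E M) (p : M) : Prop :=
  ∀ e ∈ IsManifold.maximalAtlas 𝓘(ℝ, E) ∞ M, p ∈ e.source → ∀ x z : E,
    nablaEndo (A.metricIn e) (A.JIn e) (e p) x z = 0

/-- `M` is flat on `U`: `R = 0` at every point of `U`, i.e. the components of `R` there vanish
in every smooth chart. -/
def IsFlatOn (A : AlmostHermitian E M) (U : Set M) : Prop :=
  ∀ e ∈ IsManifold.maximalAtlas 𝓘(ℝ, E) ∞ M, ∀ q ∈ e.source, q ∈ U → ∀ x z w u : E,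
    curvatureTensor (A.metricIn e) (e q) x z w u = 0

end

end AlmostHermitian

/-! The theorem reduces to a pointwise alternative: wherever `R = φ(Q)`, either `Q = 0` or `∇J = 0`.
Since `∇J ≠ 0` is an open condition, `Q`, and with it `R = φ(Q)`, vanishes near a point that is not
Kähler. The formula for `Q` through the Ricci tensor matters only because it makes `Q` smooth; the
algebraic properties of `Q` are recovered from `R = φ(Q)`.

Skew-symmetry of `R` in its first two arguments and the first Bianchi identity force `Q` to be
symmetric and `J`-invariant (`form_swap`, `form_symm`), so every `R(x, y)` commutes with `J`.
Differentiating `[R(x, y), J] = 0` and summing cyclically removes `∇R` by the second Bianchi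
identity. What is left is the vanishing of the cyclic sum of `[R(x, y), ∇_w J]`, which is algebraic
in `A = ∇J` and `Q` (`isCyclic`). Differentiating `R = φ(Q)` itself gives a second relation, which
also contains `S = ∇Q` (`isBianchi`).

Now diagonalise `Q` in a unitary frame (`exists_frame`) with eigenvalues `q i`. The cyclic identity
becomes a list of relations: a linear form in the `q i` times a component `g (A (e k) (e p)) (e r)`.
The identity is inherited by the part of `A` that is antilinear in its first argument
(`IsCyclic.minus`). With at least three indices, a nonzero component of that part makes all
eigenvalues vanish (`eigenvalue_eq_zero_of_antilinear`). So if `Q ≠ 0`, then `A` is complex linear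
in its first argument. For such `A` the relations leave one exceptional case: a single nonzero
eigenvalue `q k`, with `A` supported on the first argument `e k` and its image orthogonal to `e k`
and `J (e k)`. The cyclic identity cannot exclude it; the Bianchi identity involving `S` does
(`eigenvalue_mul_eq_zero`). -/

namespace HermitianAlgebra

/-! ### Hermitian linear algebra: unitary eigenframes and the cyclic identity. -/

open LocalGeometry

variable {E : Type*} [NormedAddCommGroup E] [NormedSpace ℝ E]

/-- A positive definite symmetric form `g` and a `g`-orthogonal complex structure `J`. -/
structure IsHermitian (g : E →L[ℝ] E →L[ℝ] ℝ) (J : E →L[ℝ] E) : Prop where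
  symm : ∀ x y, g x y = g y x
  pos : ∀ x, x ≠ 0 → 0 < g x x
  sq : ∀ x, J (J x) = -x
  inv : ∀ x y, g (J x) (J y) = g x y

namespace IsHermitian

variable {g : E →L[ℝ] E →L[ℝ] ℝ} {J : E →L[ℝ] E}

theorem left (h : IsHermitian g J) (x y : E) : g (J x) y = -g x (J y) := by
  rw [← h.inv x (J y), h.sq]; simp

theorem self (h : IsHermitian g J) (x : E) : g x (J x) = 0 := by
  have := h.left x x
  have h2 := h.symm x (J x)
  linarith

theorem swapJ (h : IsHermitian g J) (x y : E) : g x (J y) = -g y (J x) := by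
  rw [h.symm, h.left]

theorem eq_of_inner (h : IsHermitian g J) {x y : E} (hxy : ∀ u, g x u = g y u) : x = y := by
  by_contra hne
  have := h.pos (x - y) (sub_ne_zero.2 hne)
  simp only [map_sub, sub_apply] at this
  have h1 := hxy x
  have h2 := hxy y
  linarith

end IsHermitian

/-- A family of `J`-unitary eigenvectors `e i` of the form `Q`, with eigenvalues `q i`. -/
structure IsFrame {ι : Type*} (g : E →L[ℝ] E →L[ℝ] ℝ) (J : E →L[ℝ] E) (Q : E →ₗ[ℝ] E →ₗ[ℝ] ℝ)
    (q : ι → ℝ) (e : ι → E) : Prop where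
  norm : ∀ i, g (e i) (e i) = 1
  orth : ∀ i j, i ≠ j → g (e i) (e j) = 0
  orthJ : ∀ i j, g (e i) (J (e j)) = 0
  eig : ∀ i v, Q (e i) v = q i * g (e i) v

/-- A symmetric `J`-invariant form. -/
structure IsInvariantForm (J : E →L[ℝ] E) (Q : E →ₗ[ℝ] E →ₗ[ℝ] ℝ) : Prop where
  symm : ∀ x y, Q x y = Q y x
  inv : ∀ x y, Q (J x) (J y) = Q x y

theorem IsInvariantForm.left {g : E →L[ℝ] E →L[ℝ] ℝ} {J : E →L[ℝ] E} (h : IsHermitian g J)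
    {Q : E →ₗ[ℝ] E →ₗ[ℝ] ℝ} (hQ : IsInvariantForm J Q) (x y : E) : Q (J x) y = -Q x (J y) := by
  rw [← hQ.inv x (J y), h.sq]; simp

/-- `J`-antilinear `g`-skew endomorphisms `A w` whose commutator with the curvature-like operators
`φ(Q)(x, y)` has vanishing cyclic sum. -/
structure IsCyclic (g : E →L[ℝ] E →L[ℝ] ℝ) (J : E →L[ℝ] E) (Q : E →ₗ[ℝ] E →ₗ[ℝ] ℝ)
    (A : E →L[ℝ] E →L[ℝ] E) : Prop where
  anti : ∀ w z, A w (J z) = -J (A w z)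
  skew : ∀ w z u, g (A w z) u = -g (A w u) z
  cyc : ∀ w x y z u,
    (phi g J (fun a b => Q a b) x y (A w z) u + phi g J (fun a b => Q a b) x y z (A w u))
    + (phi g J (fun a b => Q a b) y w (A x z) u + phi g J (fun a b => Q a b) y w z (A x u))
    + (phi g J (fun a b => Q a b) w x (A y z) u + phi g J (fun a b => Q a b) w x z (A y u)) = 0

namespace IsCyclic

variable {g : E →L[ℝ] E →L[ℝ] ℝ} {J : E →L[ℝ] E} {Q : E →ₗ[ℝ] E →ₗ[ℝ] ℝ} {A : E →L[ℝ] E →L[ℝ] E}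

theorem midJ (h : IsHermitian g J) (hA : IsCyclic g J Q A) (w z u : E) :
    g (A w (J z)) u = g (A w z) (J u) := by
  rw [hA.anti]; simp [h.left]

theorem self (hA : IsCyclic g J Q A) (w z : E) : g (A w z) z = 0 := by
  have := hA.skew w z z; linarith

theorem selfJ (h : IsHermitian g J) (hA : IsCyclic g J Q A) (w z : E) : g (A w z) (J z) = 0 := by
  have h1 := hA.skew w z (J z)
  rw [hA.midJ h] at h1; linarith

theorem swapJ (h : IsHermitian g J) (hA : IsCyclic g J Q A) (w z u : E) :
    g (A w z) (J u) = - g (A w u) (J z) := by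
  rw [hA.skew, hA.midJ h]

end IsCyclic


namespace IsFrame

variable {ι : Type*} {g : E →L[ℝ] E →L[ℝ] ℝ} {J : E →L[ℝ] E} {Q : E →ₗ[ℝ] E →ₗ[ℝ] ℝ}
  {q : ι → ℝ} {e : ι → E}

theorem eig_right (h : IsHermitian g J) (hQ : IsInvariantForm J Q) (he : IsFrame g J Q q e)
    (i : ι) (v : E) : Q v (e i) = q i * g v (e i) := by
  rw [hQ.symm, he.eig, h.symm]

/-- Replacing one vector `e r` of a frame by `J (e r)` gives a frame. -/
theorem rotate [DecidableEq ι] (h : IsHermitian g J) (hQ : IsInvariantForm J Q)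
    (he : IsFrame g J Q q e) (r : ι) : IsFrame g J Q q (Function.update e r (J (e r))) where
  norm i := by
    rcases eq_or_ne i r with rfl | hi
    · simp [h.inv, he.norm]
    · simp [hi, he.norm]
  orth i j hij := by
    rcases eq_or_ne i r with rfl | hi
    · simp [hij.symm, h.left, he.orthJ]
    · rcases eq_or_ne j r with rfl | hj
      · simp [hi, he.orthJ]
      · simp [hi, hj, he.orth i j hij]
  orthJ i j := by
    rcases eq_or_ne i r with rfl | hi
    · rcases eq_or_ne j i with rfl | hj
      · simp [h.inv, he.orthJ]
      · simp [hj, h.inv, he.orth i j hj.symm]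
    · rcases eq_or_ne j r with rfl | hj
      · simp [hi, h.sq, he.orth i j hi]
      · simp [hi, hj, he.orthJ]
  eig i v := by
    rcases eq_or_ne i r with rfl | hi
    · simp [h.left, hQ.left h, he.eig]
    · simp [hi, he.eig]

end IsFrame

/-! ### The cyclic identity in components with respect to an eigenframe. -/

section FrameEquations

set_option linter.unusedSimpArgs false

variable {ι : Type*} {g : E →L[ℝ] E →L[ℝ] ℝ} {J : E →L[ℝ] E} {Q : E →ₗ[ℝ] E →ₗ[ℝ] ℝ}
  {q : ι → ℝ} {e : ι → E} {A : E →L[ℝ] E →L[ℝ] E}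

/-- The first pair `(x, y) = (e i, J (e i))` is orthogonal to all other vectors in play, so the
terms with `A (e i)` and `A (J (e i))` drop out. In the `A (e k)` terms only the summands of `φ`
containing `g x (J y)` or `Q x (J y)` survive. Hence the type of `A` in its first argument is
immaterial, and `ε` may be arbitrary. -/
theorem distinct_eq (h : IsHermitian g J) (hQ : IsInvariantForm J Q)
    (hA : IsCyclic g J Q A) (he : IsFrame g J Q q e)
    {ε : ℝ} (hε : ∀ w z, A (J w) z = ε • J (A w z)) {i k p r : ι}
    (hik : i ≠ k) (hip : i ≠ p) (hir : i ≠ r) (hkp : k ≠ p) (hkr : k ≠ r) :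
    (2 * q i + q p + q r) * g (A (e k) (e p)) (e r) = 0 := by
  have h1 := hA.cyc (e k) (e i) (J (e i)) (e p) (J (e r))
  -- `s1` and `s2` bring every value of `A` into the left slot of `g`, so that equal components
  -- become syntactically equal up to `skew`.
  have s1 : ∀ a b c, g a (A b c) = g (A b c) a := fun a b c => h.symm _ _
  have s2 : ∀ a b c, g a (J (A b c)) = -g (A b c) (J a) := fun a b c => h.swapJ _ _
  simp [phi, h.left, h.sq, h.inv, hQ.left h, hA.midJ h, hA.self, hA.selfJ h, hε, he.eig, he.eig_right h hQ,
    s1, s2, he.norm, he.orth, he.orthJ, hik, hik.symm, hip, hip.symm, hir, hir.symm, hkp, hkp.symm, hkr, hkr.symm] at h1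
  linear_combination (-1 / 2) * h1 + (q i + q p) * hA.skew (e k) (e r) (e p)

theorem two_mul_diag_of_antilinear (h : IsHermitian g J) (hQ : IsInvariantForm J Q)
    (hA : IsCyclic g J Q A) (he : IsFrame g J Q q e)
    (hε : ∀ w z, A (J w) z = -J (A w z)) {i k r : ι}
    (hik : i ≠ k) (hir : i ≠ r) (hkr : k ≠ r) :
    (2 * q i + q k + q r) * g (A (e k) (e k)) (e r) = 0 := by
  have h1 := hA.cyc (e k) (e i) (J (e i)) (e k) (J (e r))
  have s1 : ∀ a b c, g a (A b c) = g (A b c) a := fun a b c => h.symm _ _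
  have s2 : ∀ a b c, g a (J (A b c)) = -g (A b c) (J a) := fun a b c => h.swapJ _ _
  simp [phi, h.left, h.sq, h.inv, hQ.left h, hA.midJ h, hA.self, hA.selfJ h, hε, he.eig, he.eig_right h hQ,
    s1, s2, he.norm, he.orth, he.orthJ, hik, hik.symm, hir, hir.symm, hkr, hkr.symm] at h1
  linear_combination (-1 / 2) * h1 + (q i + q k) * hA.skew (e k) (e r) (e k)

theorem five_mul_swap_of_antilinear (h : IsHermitian g J) (hQ : IsInvariantForm J Q)
    (hA : IsCyclic g J Q A) (he : IsFrame g J Q q e)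
    (hε : ∀ w z, A (J w) z = -J (A w z)) {i k r : ι}
    (hik : i ≠ k) (hir : i ≠ r) (hkr : k ≠ r) :
    (5 * q i + q r) * g (A (e k) (e i)) (e r) = (q k + q i) * g (A (e i) (e k)) (e r) := by
  have h1 := hA.cyc (e k) (e i) (J (e i)) (e i) (J (e r))
  have s1 : ∀ a b c, g a (A b c) = g (A b c) a := fun a b c => h.symm _ _
  have s2 : ∀ a b c, g a (J (A b c)) = -g (A b c) (J a) := fun a b c => h.swapJ _ _
  simp [phi, h.left, h.sq, h.inv, hQ.left h, hA.midJ h, hA.self, hA.selfJ h, hε, he.eig, he.eig_right h hQ,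
    s1, s2, he.norm, he.orth, he.orthJ, hik, hik.symm, hir, hir.symm, hkr, hkr.symm] at h1
  linear_combination (-1 / 2) * h1 + 4 * q i * hA.skew (e k) (e r) (e i) - (q i + q k) * hA.skew (e i) (e r) (e k)

theorem five_mul_diag_of_antilinear (h : IsHermitian g J) (hQ : IsInvariantForm J Q)
    (hA : IsCyclic g J Q A) (he : IsFrame g J Q q e)
    (hε : ∀ w z, A (J w) z = -J (A w z)) {i k : ι}
    (hik : i ≠ k) :
    (5 * q i + q k) * g (A (e k) (e k)) (e i) = 0 := by
  have h1 := hA.cyc (e k) (e i) (J (e i)) (e i) (J (e k))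
  have s1 : ∀ a b c, g a (A b c) = g (A b c) a := fun a b c => h.symm _ _
  have s2 : ∀ a b c, g a (J (A b c)) = -g (A b c) (J a) := fun a b c => h.swapJ _ _
  simp [phi, h.left, h.sq, h.inv, hQ.left h, hA.midJ h, hA.self, hA.selfJ h, hε, he.eig, he.eig_right h hQ,
    s1, s2, he.norm, he.orth, he.orthJ, hik, hik.symm] at h1
  linear_combination (1 / 2) * h1 + (q i + q k) * hA.skew (e k) (e i) (e k)

theorem sum_mul_diag_of_antilinear (h : IsHermitian g J) (hQ : IsInvariantForm J Q)
    (hA : IsCyclic g J Q A) (he : IsFrame g J Q q e)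
    (hε : ∀ w z, A (J w) z = -J (A w z)) {i j k : ι}
    (hik : i ≠ k) (hij : i ≠ j) (hjk : j ≠ k) :
    (q i + q j) * g (A (e k) (e k)) (e i) = 0 := by
  have h1 := hA.cyc (e k) (e i) (J (e j)) (e j) (J (e k))
  have h2 := hA.cyc (J (e k)) (e i) (J (e j)) (e j) (e k)
  have s1 : ∀ a b c, g a (A b c) = g (A b c) a := fun a b c => h.symm _ _
  have s2 : ∀ a b c, g a (J (A b c)) = -g (A b c) (J a) := fun a b c => h.swapJ _ _
  simp [phi, h.left, h.sq, h.inv, hQ.left h, hA.midJ h, hA.self, hA.selfJ h, hε, he.eig, he.eig_right h hQ,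
    s1, s2, he.norm, he.orth, he.orthJ, hik, hik.symm, hij, hij.symm, hjk, hjk.symm] at h1 h2
  linear_combination (1 / 2) * (h1 + h2)

theorem five_mul_of_linear (h : IsHermitian g J) (hQ : IsInvariantForm J Q)
    (hA : IsCyclic g J Q A) (he : IsFrame g J Q q e)
    (hε : ∀ w z, A (J w) z = J (A w z)) {p k r : ι}
    (hkp : k ≠ p) (hpr : p ≠ r) (hkr : k ≠ r) :
    (5 * q p + q r) * g (A (e k) (e p)) (e r) = 0 := by
  have h1 := hA.cyc (e k) (e p) (J (e p)) (e p) (J (e r))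
  have s1 : ∀ a b c, g a (A b c) = g (A b c) a := fun a b c => h.symm _ _
  have s2 : ∀ a b c, g a (J (A b c)) = -g (A b c) (J a) := fun a b c => h.swapJ _ _
  simp [phi, h.left, h.sq, h.inv, hQ.left h, hA.midJ h, hA.self, hA.selfJ h, hε, he.eig, he.eig_right h hQ,
    s1, s2, he.norm, he.orth, he.orthJ, hkp, hkp.symm, hpr, hpr.symm, hkr, hkr.symm] at h1
  linear_combination (-1 / 2) * h1 + 4 * q p * hA.skew (e k) (e r) (e p)

theorem five_mul_diag_of_linear (h : IsHermitian g J) (hQ : IsInvariantForm J Q)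
    (hA : IsCyclic g J Q A) (he : IsFrame g J Q q e)
    (hε : ∀ w z, A (J w) z = J (A w z)) {k r : ι}
    (hkr : k ≠ r) :
    (5 * q r + q k) * g (A (e k) (e k)) (e r) = 0 := by
  have h1 := hA.cyc (e k) (e r) (J (e r)) (e k) (J (e r))
  have s1 : ∀ a b c, g a (A b c) = g (A b c) a := fun a b c => h.symm _ _
  have s2 : ∀ a b c, g a (J (A b c)) = -g (A b c) (J a) := fun a b c => h.swapJ _ _
  simp [phi, h.left, h.sq, h.inv, hQ.left h, hA.midJ h, hA.self, hA.selfJ h, hε, he.eig, he.eig_right h hQ,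
    s1, s2, he.norm, he.orth, he.orthJ, hkr, hkr.symm] at h1
  linear_combination (-1 / 2) * h1 + (q r + q k) * hA.skew (e k) (e r) (e k)

theorem two_mul_diag_of_linear (h : IsHermitian g J) (hQ : IsInvariantForm J Q)
    (hA : IsCyclic g J Q A) (he : IsFrame g J Q q e)
    (hε : ∀ w z, A (J w) z = J (A w z)) {i k r : ι}
    (hik : i ≠ k) (hir : i ≠ r) (hkr : k ≠ r) :
    (2 * q i + q k + q r) * g (A (e k) (e k)) (e r) = (q i + q k) * g (A (e i) (e i)) (e r) := by
  have h1 := hA.cyc (e k) (e i) (J (e i)) (e k) (J (e r))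
  have s1 : ∀ a b c, g a (A b c) = g (A b c) a := fun a b c => h.symm _ _
  have s2 : ∀ a b c, g a (J (A b c)) = -g (A b c) (J a) := fun a b c => h.swapJ _ _
  simp [phi, h.left, h.sq, h.inv, hQ.left h, hA.midJ h, hA.self, hA.selfJ h, hε, he.eig, he.eig_right h hQ,
    s1, s2, he.norm, he.orth, he.orthJ, hik, hik.symm, hir, hir.symm, hkr, hkr.symm] at h1
  linear_combination (-1 / 2) * h1 + (q i + q k) * hA.skew (e k) (e r) (e k) - (q i + q k) * hA.skew (e i) (e r) (e i)

theorem sum_mul_diag_of_linear (h : IsHermitian g J) (hQ : IsInvariantForm J Q)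
    (hA : IsCyclic g J Q A) (he : IsFrame g J Q q e)
    (hε : ∀ w z, A (J w) z = J (A w z)) {i k r : ι}
    (hik : i ≠ k) (hir : i ≠ r) (hkr : k ≠ r) :
    (q r + q i) * g (A (e k) (e k)) (e r) = -((q r + q k) * g (A (e i) (e i)) (e r)) := by
  have h1 := hA.cyc (e k) (e i) (J (e r)) (e k) (J (e i))
  have s1 : ∀ a b c, g a (A b c) = g (A b c) a := fun a b c => h.symm _ _
  have s2 : ∀ a b c, g a (J (A b c)) = -g (A b c) (J a) := fun a b c => h.swapJ _ _
  simp [phi, h.left, h.sq, h.inv, hQ.left h, hA.midJ h, hA.self, hA.selfJ h, hε, he.eig, he.eig_right h hQ,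
    s1, s2, he.norm, he.orth, he.orthJ, hik, hik.symm, hir, hir.symm, hkr, hkr.symm] at h1
  linear_combination -h1

end FrameEquations

end HermitianAlgebra

/-! ### A nonzero component of `A` makes eigenvalues of `Q` vanish. -/

namespace HermitianAlgebra

open LocalGeometry

/-- Here `a, b, c` are the eigenvalues at three distinct indices, and `X, Y, Z` the components of an
antilinear `A` under cyclic permutation of the indices. The six equations form three homogeneous `2
× 2` systems, one for each pair of unknowns, and a nonzero unknown forces the determinants of its
two systems to vanish. -/
theorem eq_zero_of_cyclic_system {a b c X Y Z : ℝ} (h1 : (5 * b + c) * X = -((a + b) * Y))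
    (h2 : (5 * c + b) * X = -((a + c) * Z)) (h3 : (5 * c + a) * Y = -((b + c) * Z))
    (h4 : (5 * a + c) * Y = -((b + a) * X)) (h5 : (5 * a + b) * Z = -((c + a) * X))
    (h6 : (5 * b + a) * Z = -((c + b) * Y)) (hX : X ≠ 0) : a = 0 ∧ b = 0 ∧ c = 0 := by
  have f12 : (5 * b + c) * (5 * a + c) - (a + b) ^ 2 = 0 := by
    apply (mul_eq_zero.1 (_ : ((5 * b + c) * (5 * a + c) - (a + b) ^ 2) * X = 0)).resolve_right hX
    linear_combination (5 * a + c) * h1 - (a + b) * h4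
  have f13 : (5 * c + b) * (5 * a + b) - (a + c) ^ 2 = 0 := by
    apply (mul_eq_zero.1 (_ : ((5 * c + b) * (5 * a + b) - (a + c) ^ 2) * X = 0)).resolve_right hX
    linear_combination (5 * a + b) * h2 - (a + c) * h5
  by_cases hY : Y = 0
  · subst hY
    have k1 : 5 * b + c = 0 := by simpa [hX] using h1
    have k2 : b + a = 0 := by simpa [hX] using h4
    have hb : b = 0 := by
      have k3 : b * Z = 0 := by linear_combination (-1 / 4) * h3 + (1 / 4) * Z * k1
      rcases mul_eq_zero.1 k3 with h | h
      · exact h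
      · subst h
        have : 5 * c + b = 0 := by simpa [hX] using h2
        linarith
    exact ⟨by linarith, hb, by linarith⟩
  · have f23 : (5 * c + a) * (5 * b + a) - (b + c) ^ 2 = 0 := by
      apply (mul_eq_zero.1 (_ : ((5 * c + a) * (5 * b + a) - (b + c) ^ 2) * Y = 0)).resolve_right hY
      linear_combination (5 * b + a) * h3 - (b + c) * h6
    -- Differences of two determinants factor. Their zero sets leave only `a = b = c`, or two values
    -- equal and the third eight times as large; `fin` excludes the latter, where the determinant is
    -- `165 * t ^ 2`.
    have d1 : (b - c) * (9 * a - b - c) = 0 := by linear_combination (f12 - f13) / 2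
    have d2 : (a - c) * (9 * b - a - c) = 0 := by linear_combination (f12 - f23) / 2
    have d3 : (a - b) * (9 * c - a - b) = 0 := by linear_combination (f13 - f23) / 2
    have sq : ∀ {t : ℝ}, t ^ 2 = 0 → t = 0 := fun h => pow_eq_zero_iff two_ne_zero |>.1 h
    have fin : ∀ {x y t : ℝ}, x = t → y = 8 * t →
        (5 * x + y) * (5 * t + y) - (t + x) ^ 2 = 0 → t = 0 := fun hx hy hf => by
      rw [hx, hy] at hf; exact sq (by linear_combination hf / 165)
    rcases mul_eq_zero.1 d1 with e1 | e1
    · rcases mul_eq_zero.1 d2 with e2 | e2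
      · have hb : b = a := by linarith
        have hc : c = a := by linarith
        rw [hb, hc] at f12
        have : a = 0 := sq (by linear_combination f12 / 32)
        exact ⟨this, by linarith, by linarith⟩
      · have : b = 0 := fin (x := c) (y := a) (by linarith) (by linarith)
          (by linear_combination f23)
        exact ⟨by linarith, this, by linarith⟩
    · rcases mul_eq_zero.1 d2 with e2 | e2
      · have : a = 0 := fin (x := c) (y := b) (by linarith) (by linarith)
          (by linear_combination f13)
        exact ⟨this, by linarith, by linarith⟩
      · have : a = 0 := fin (x := b) (y := c) (by linarith) (by linarith)
          (by linear_combination f12)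
        exact ⟨this, by linarith, by linarith⟩

variable {E : Type*} [NormedAddCommGroup E] [NormedSpace ℝ E]
variable {ι : Type*} {g : E →L[ℝ] E →L[ℝ] ℝ} {J : E →L[ℝ] E} {Q : E →ₗ[ℝ] E →ₗ[ℝ] ℝ}
  {q : ι → ℝ} {e : ι → E} {A : E →L[ℝ] E →L[ℝ] E}

theorem exists_ne_ne [Fintype ι] (hι : 3 ≤ Fintype.card ι) (k r : ι) : ∃ j, j ≠ k ∧ j ≠ r := by
  classical
  obtain ⟨j, hj⟩ := Finset.exists_mem_notMem_of_card_lt_card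
    (s := {k, r}) (t := (Finset.univ : Finset ι))
    (lt_of_le_of_lt Finset.card_le_two (by rw [Finset.card_univ]; omega))
  refine ⟨j, ?_⟩
  simpa using hj.2

/-- By skewness a nonzero component has either a repeated index, brought to the form `(k, k, r)`, or
three distinct indices. The first kind needs a third index `j` to supply enough relations. The
second is `eq_zero_of_cyclic_system`, with `distinct_eq` for the remaining indices. -/
theorem eigenvalue_eq_zero_of_antilinear [Fintype ι] (hι : 3 ≤ Fintype.card ι) (h : IsHermitian g J)
    (hQ : IsInvariantForm J Q) (hA : IsCyclic g J Q A) (he : IsFrame g J Q q e)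
    (hε : ∀ w z, A (J w) z = -J (A w z)) {k p r : ι} (hF : g (A (e k) (e p)) (e r) ≠ 0) (i : ι) :
    q i = 0 := by
  have kind1 : ∀ k r, g (A (e k) (e k)) (e r) ≠ 0 → ∀ i, q i = 0 := by
    intro k r hF i
    have hkr : k ≠ r := by rintro rfl; exact hF (hA.self _ _)
    have h1 := (mul_eq_zero.1 (five_mul_diag_of_antilinear h hQ hA he hε hkr.symm)).resolve_right hF
    have h2 : ∀ j, j ≠ k → j ≠ r → q r = 0 ∧ q k = 0 ∧ q j = 0 := by
      intro j jk jr
      have h3 := (mul_eq_zero.1 (sum_mul_diag_of_antilinear h hQ hA he hε hkr.symm jr.symm jk)).resolve_right hF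
      have h4 := (mul_eq_zero.1 (two_mul_diag_of_antilinear h hQ hA he hε jk jr hkr)).resolve_right hF
      exact ⟨by linarith, by linarith, by linarith⟩
    obtain ⟨j, jk, jr⟩ := exists_ne_ne hι k r
    by_cases ik : i = k
    · rw [ik]; exact (h2 j jk jr).2.1
    by_cases ir : i = r
    · rw [ir]; exact (h2 j jk jr).1
    · exact (h2 i ik ir).2.2
  have hpr : p ≠ r := by rintro rfl; exact hF (hA.self _ _)
  by_cases hkp : k = p
  · subst hkp; exact kind1 k r hF i
  by_cases hkr : k = r
  · subst hkr
    exact kind1 k p (by rw [hA.skew]; exact neg_ne_zero.2 hF) i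
  have sk := hA.skew
  obtain ⟨a1, a2, a3⟩ := eq_zero_of_cyclic_system (a := q k) (b := q p) (c := q r)
    (X := g (A (e k) (e p)) (e r)) (Y := g (A (e p) (e r)) (e k)) (Z := g (A (e r) (e k)) (e p))
    (by linear_combination five_mul_swap_of_antilinear h hQ hA he hε (Ne.symm hkp) hpr hkr
          + (q k + q p) * sk (e p) (e r) (e k))
    (by linear_combination -five_mul_swap_of_antilinear h hQ hA he hε (Ne.symm hkr) hpr.symm hkp
          + (5 * q r + q p) * sk (e k) (e p) (e r))
    (by linear_combination five_mul_swap_of_antilinear h hQ hA he hε hpr.symm (Ne.symm hkr) (Ne.symm hkp)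
          + (q p + q r) * sk (e r) (e k) (e p))
    (by linear_combination -five_mul_swap_of_antilinear h hQ hA he hε hkp hkr hpr
          + (5 * q k + q r) * sk (e p) (e r) (e k))
    (by linear_combination five_mul_swap_of_antilinear h hQ hA he hε hkr hkp hpr.symm
          + (q k + q r) * sk (e k) (e p) (e r))
    (by linear_combination -five_mul_swap_of_antilinear h hQ hA he hε hpr (Ne.symm hkp) (Ne.symm hkr)
          + (5 * q p + q k) * sk (e r) (e k) (e p)) hF
  by_cases ik : i = k
  · rw [ik, a1]
  by_cases ip : i = p
  · rw [ip, a2]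
  by_cases ir : i = r
  · rw [ir, a3]
  have := (mul_eq_zero.1 (distinct_eq (ε := -1) h hQ hA he (by simpa using hε) ik ip ir hkp
    hkr)).resolve_right hF
  linarith

theorem eigenvalue_eq_zero_of_linear_of_self [Fintype ι] (hι : 3 ≤ Fintype.card ι) (h : IsHermitian g J)
    (hQ : IsInvariantForm J Q) (hA : IsCyclic g J Q A) (he : IsFrame g J Q q e)
    (hε : ∀ w z, A (J w) z = J (A w z)) {k r : ι} (hF : g (A (e k) (e k)) (e r) ≠ 0) (i : ι) :
    q i = 0 := by
  have hkr : k ≠ r := by rintro rfl; exact hF (hA.self _ _)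
  have h1 := (mul_eq_zero.1 (five_mul_diag_of_linear h hQ hA he hε hkr)).resolve_right hF
  have h2 : ∀ i, i ≠ k → i ≠ r → q r = 0 ∧ q k = 0 ∧ q i = 0 := by
    intro i ik ir
    have c := two_mul_diag_of_linear h hQ hA he hε ik ir hkr
    have d := sum_mul_diag_of_linear h hQ hA he hε ik ir hkr
    by_cases hY : g (A (e i) (e i)) (e r) = 0
    · rw [hY] at c d
      simp only [mul_zero, neg_zero, mul_eq_zero, hF, or_false] at c d
      exact ⟨by linarith, by linarith, by linarith⟩
    · have h3 := (mul_eq_zero.1 (five_mul_diag_of_linear h hQ hA he hε ir)).resolve_right hY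
      have qk : q k = -5 * q r := by linarith
      have qi : q i = -5 * q r := by linarith
      rw [qk, qi] at c d
      -- With `q k = q i = -5 * q r`, and `X`, `Y` the components at `k` and `i`, `c` reads `-14 q_r
      -- X = -10 q_r Y` and `d` reads `-4 q_r X = 4 q_r Y`; eliminating `Y` leaves `q_r X = 0`.
      have : q r * g (A (e k) (e k)) (e r) = 0 := by linear_combination (-1 / 24) * c - (5 / 48) * d
      have qr := (mul_eq_zero.1 this).resolve_right hF
      exact ⟨qr, by linarith, by linarith⟩
  obtain ⟨j, jk, jr⟩ := exists_ne_ne hι k r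
  by_cases ik : i = k
  · rw [ik]; exact (h2 j jk jr).2.1
  by_cases ir : i = r
  · rw [ir]; exact (h2 j jk jr).1
  · exact (h2 i ik ir).2.2

/-- For distinct `k, p, r` the relations used are `5 q_p + q_r = 0 = 5 q_r + q_p` and `2 q_i + q_p +
q_r = 0`, none of which contains `q k`. This is why `i = k` is excluded, and the source of the
exceptional case. -/
theorem eigenvalue_eq_zero_of_linear_of_ne [Fintype ι] (hι : 3 ≤ Fintype.card ι) (h : IsHermitian g J)
    (hQ : IsInvariantForm J Q) (hA : IsCyclic g J Q A) (he : IsFrame g J Q q e)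
    (hε : ∀ w z, A (J w) z = J (A w z)) {k p r : ι} (hF : g (A (e k) (e p)) (e r) ≠ 0) {i : ι}
    (ik : i ≠ k) : q i = 0 := by
  have hpr : p ≠ r := by rintro rfl; exact hF (hA.self _ _)
  have hF' : g (A (e k) (e r)) (e p) ≠ 0 := by rw [hA.skew]; exact neg_ne_zero.2 hF
  by_cases hkp : k = p
  · subst hkp; exact eigenvalue_eq_zero_of_linear_of_self hι h hQ hA he hε hF i
  by_cases hkr : k = r
  · subst hkr; exact eigenvalue_eq_zero_of_linear_of_self hι h hQ hA he hε hF' i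
  have h1 := (mul_eq_zero.1 (five_mul_of_linear h hQ hA he hε hkp hpr hkr)).resolve_right hF
  have h2 := (mul_eq_zero.1 (five_mul_of_linear h hQ hA he hε hkr hpr.symm hkp)).resolve_right hF'
  by_cases ip : i = p
  · rw [ip]; linarith
  by_cases ir : i = r
  · rw [ir]; linarith
  have := (mul_eq_zero.1 (distinct_eq (ε := 1) h hQ hA he (by simpa using hε) ik ip ir hkp
    hkr)).resolve_right hF
  linarith

/-- A `J`-unitary frame is complete if every vector is the sum of its components. -/
def IsComplete [Fintype ι] (g : E →L[ℝ] E →L[ℝ] ℝ) (J : E →L[ℝ] E) (e : ι → E) : Prop :=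
  ∀ v, v = ∑ i, (g v (e i) • e i + g v (J (e i)) • J (e i))

theorem IsComplete.eq_zero [Fintype ι] (hc : IsComplete g J e) {v : E} (h1 : ∀ i, g v (e i) = 0)
    (h2 : ∀ i, g v (J (e i)) = 0) : v = 0 := by
  rw [hc v]; simp [h1, h2]

theorem IsComplete.rotate [Fintype ι] [DecidableEq ι] (h : IsHermitian g J)
    (hc : IsComplete g J e) (r : ι) : IsComplete g J (Function.update e r (J (e r))) := by
  intro v
  conv_lhs => rw [hc v]
  refine Finset.sum_congr rfl fun i _ => ?_
  rcases eq_or_ne i r with rfl | hi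
  · simp [h.sq, add_comm]
  · simp [hi]

/-- The relations control only the components along the vectors `e r`. Those along `J (e r)` are
components of the first kind in a frame where one vector has been rotated by `J`; this is why `H`
ranges over all eigenframes with the same eigenvalues. -/
theorem apply_frame_eq_zero [Fintype ι] [DecidableEq ι] (h : IsHermitian g J)
    (hQ : IsInvariantForm J Q) (hA : IsCyclic g J Q A) (he : IsFrame g J Q q e)
    (hc : IsComplete g J e) {k p : ι}
    (H : ∀ e', IsFrame g J Q q e' → IsComplete g J e' → ∀ r, g (A (e' k) (e' p)) (e' r) = 0) :
    A (e k) (e p) = 0 := by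
  refine hc.eq_zero (H e he hc) fun r => ?_
  rcases eq_or_ne r p with rfl | hp
  · exact hA.selfJ h _ _
  rcases eq_or_ne r k with rfl | hk
  -- Rotating `e r` would here change the first argument `e k` as well, so `J` is moved onto `e p`
  -- and that vector is rotated instead.
  · have := H _ (he.rotate h hQ p) (hc.rotate h p) r
    rw [hA.swapJ h, neg_eq_zero, hA.skew]
    simpa [hp, hA.midJ h, hp] using this
  · have := H _ (he.rotate h hQ r) (hc.rotate h r) r
    simpa [hp.symm, hk.symm] using this

theorem eq_zero_of_frame [Fintype ι] (h : IsHermitian g J)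
    (hA : IsCyclic g J Q A) (hc : IsComplete g J e) {w : E} (H : ∀ p, A w (e p) = 0) :
    A w = 0 := by
  ext z
  refine hc.eq_zero (fun r => ?_) fun r => ?_
  · rw [hA.skew, H]; simp
  · rw [hA.swapJ h, H]; simp

theorem eq_zero_of_frame_left [Fintype ι] (hc : IsComplete g J e) (H : ∀ k, A (e k) = 0)
    (HJ : ∀ k, A (J (e k)) = 0) : A = 0 := by
  ext w : 1
  rw [hc w]; simp [H, HJ]

end HermitianAlgebra

/-! ### Splitting `A` by type, and the differentiated Bianchi identity. -/

namespace HermitianAlgebra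

open LocalGeometry

set_option linter.unusedSimpArgs false

variable {E : Type*} [NormedAddCommGroup E] [NormedSpace ℝ E]
variable {ι : Type*} {g : E →L[ℝ] E →L[ℝ] ℝ} {J : E →L[ℝ] E} {Q : E →ₗ[ℝ] E →ₗ[ℝ] ℝ}
  {q : ι → ℝ} {e : ι → E} {A : E →L[ℝ] E →L[ℝ] E}

/-- The derivative of `phi g J Q` with respect to `J`, in the direction `K`. -/
noncomputable def dphi (g : E →L[ℝ] E →L[ℝ] ℝ) (J K : E →L[ℝ] E) (Q : E → E → ℝ)
    (x y z u : E) : ℝ :=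
  g x (K u) * Q y (J z) + g x (J u) * Q y (K z) - (g x (K z) * Q y (J u) + g x (J z) * Q y (K u))
    - 2 * (g x (K y) * Q z (J u) + g x (J y) * Q z (K u))
    + (g y (K z) * Q x (J u) + g y (J z) * Q x (K u))
    - (g y (K u) * Q x (J z) + g y (J u) * Q x (K z))
    - 2 * (g z (K u) * Q x (J y) + g z (J u) * Q x (K y))

theorem phi_J_left (h : IsHermitian g J) (hQ : IsInvariantForm J Q) (x y z u : E) :
    phi g J (fun a b => Q a b) (J x) y z u = -phi g J (fun a b => Q a b) x (J y) z u := by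
  simp only [phi, h.left, h.sq, hQ.left h, map_neg]; ring

theorem phi_J_right (h : IsHermitian g J) (hQ : IsInvariantForm J Q) (x y z u : E) :
    phi g J (fun a b => Q a b) x y (J z) u = -phi g J (fun a b => Q a b) x y z (J u) := by
  simp only [phi, h.left, h.sq, hQ.left h, map_neg]; ring

theorem phi_add_third (x y z z' u : E) :
    phi g J (fun a b => Q a b) x y (z + z') u
      = phi g J (fun a b => Q a b) x y z u + phi g J (fun a b => Q a b) x y z' u := by
  simp only [phi, map_add, LinearMap.add_apply, add_apply]; ring

theorem phi_add_fourth (x y z u u' : E) :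
    phi g J (fun a b => Q a b) x y z (u + u')
      = phi g J (fun a b => Q a b) x y z u + phi g J (fun a b => Q a b) x y z u' := by
  simp only [phi, map_add]; ring

theorem phi_neg_fourth (x y z u : E) :
    phi g J (fun a b => Q a b) x y z (-u) = -phi g J (fun a b => Q a b) x y z u := by
  simp only [phi, map_neg]; ring

/-- The operators `A - J ∘ A ∘ J` (up to sign the part of `A` that is antilinear in the first
argument) satisfy the same cyclic identity. -/
theorem IsCyclic.minus (h : IsHermitian g J) (hQ : IsInvariantForm J Q) (hA : IsCyclic g J Q A) :
    IsCyclic g J Q (A + (ContinuousLinearMap.compL ℝ E E E J) ∘L (A ∘L J)) where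
  anti w z := by simp [hA.anti, h.sq]; abel
  skew w z u := by
    simp only [add_apply, map_add, ContinuousLinearMap.comp_apply,
      ContinuousLinearMap.compL_apply, h.left]
    rw [hA.skew w z u, hA.swapJ h (J w) z u]; ring
  cyc w x y z u := by
    have s1 : ∀ b c, J (A b c) = -(A b (J c)) := fun b c => by rw [hA.anti]; simp
    have s2 : ∀ x y z w u, phi g J (fun a b => Q a b) x y z (J (A w u))
        = -phi g J (fun a b => Q a b) x y z (A w (J u)) := fun x y z w u => by
      rw [s1, phi_neg_fourth]
    -- In `h2`, `h3`, `h4` one of `w, x, y` is twisted by `J`, together with `u`. Since `φ(Jx, y) =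
    -- -φ(x, Jy)`, the terms in which the twist does not fall on the argument of `A` cancel in
    -- pairs. The others give the cyclic sum for `J ∘ A ∘ J`.
    have h1 := hA.cyc w x y z u
    have h2 := hA.cyc (J w) x y z (J u)
    have h3 := hA.cyc w (J x) y z (J u)
    have h4 := hA.cyc w x (J y) z (J u)
    simp only [add_apply, ContinuousLinearMap.comp_apply, ContinuousLinearMap.compL_apply,
      phi_add_third, phi_add_fourth, s2, phi_J_right h hQ, phi_J_left h hQ] at h1 h2 h3 h4 ⊢
    linear_combination h1 - h2 - h3 - h4

/-- Covariant derivatives `A` of `J` and `S` of `Q`, together with the second Bianchi identity. -/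
structure IsBianchi (g : E →L[ℝ] E →L[ℝ] ℝ) (J : E →L[ℝ] E) (Q : E →ₗ[ℝ] E →ₗ[ℝ] ℝ)
    (A : E →L[ℝ] E →L[ℝ] E) (S : E → E →ₗ[ℝ] E →ₗ[ℝ] ℝ) : Prop where
  symm : ∀ w x y, S w x y = S w y x
  inv : ∀ w x y, S w (J x) (J y) + Q (A w x) (J y) + Q (J x) (A w y) = S w x y
  bianchi : ∀ w x y z u,
    (phi g J (fun a b => S w a b) x y z u + dphi g J (A w) (fun a b => Q a b) x y z u)
    + (phi g J (fun a b => S x a b) y w z u + dphi g J (A x) (fun a b => Q a b) y w z u)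
    + (phi g J (fun a b => S y a b) w x z u + dphi g J (A y) (fun a b => Q a b) w x z u) = 0

/-- This excludes the exceptional case. As `Q` annihilates the image of `A`, the form `S w` is
`J`-invariant, and the only surviving `dphi` terms are those with `A (e k)` or `A (J (e k))` and
last pair `(e k, J (e k))`. -/
theorem eigenvalue_mul_eq_zero (h : IsHermitian g J) (hQ : IsInvariantForm J Q)
    (hA : IsCyclic g J Q A) {S : E → E →ₗ[ℝ] E →ₗ[ℝ] ℝ}
    (hS : IsBianchi g J Q A S) (he : IsFrame g J Q q e) 
    (hε : ∀ w z, A (J w) z = J (A w z)) {k p r : ι} (hkp : k ≠ p) (hkr : k ≠ r) (hpr : p ≠ r)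
    (hp : q p = 0) (hr : q r = 0) (Ap : A (e p) = 0) (Ar : A (e r) = 0)
    (hQA : ∀ a b c, Q (A a b) c = 0) :
    q k * g (A (e k) (e p)) (e r) = 0 := by
  have QA : ∀ a b c, Q c (A a b) = 0 := fun a b c => by rw [hQ.symm, hQA]
  have inv : ∀ w x y, S w (J x) y = - S w x (J y) := fun w x y => by
    have := hS.inv w x (J y)
    rw [hQA, QA, h.sq] at this; simp at this; linarith
  have s1 : ∀ a b c, g a (A b c) = g (A b c) a := fun a b c => h.symm _ _
  have s2 : ∀ a b c, g a (J (A b c)) = -g (A b c) (J a) := fun a b c => h.swapJ _ _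
  have sw : ∀ w x y, S w x (J y) = - S w y (J x) := fun w x y => by
    rw [hS.symm, inv]
  have self : ∀ w x, S w x (J x) = 0 := fun w x => by linarith [sw w x x]
  -- The first three arguments carry an even number of `J`'s, and the last two are `(e a, J (e a))`
  -- for `a = k, p, r`. For each `a`, the combination first − second + third + fourth cancels the `S
  -- (e k)` and `S (J (e k))` terms. The equations for `a = p` and `a = r` contain no `A` and make
  -- the two remaining combinations of `S` vanish; the one for `a = k` then gives the claim.
  have a1 := hS.bianchi (e k) (e p) (e r) (e k) (J (e k))
  have b1 := hS.bianchi (e k) (e p) (e r) (e p) (J (e p))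
  have c1 := hS.bianchi (e k) (e p) (e r) (e r) (J (e r))
  have a2 := hS.bianchi (e k) (J (e p)) (J (e r)) (e k) (J (e k))
  have b2 := hS.bianchi (e k) (J (e p)) (J (e r)) (e p) (J (e p))
  have c2 := hS.bianchi (e k) (J (e p)) (J (e r)) (e r) (J (e r))
  have a3 := hS.bianchi (J (e k)) (J (e p)) ((e r)) (e k) (J (e k))
  have b3 := hS.bianchi (J (e k)) (J (e p)) ((e r)) (e p) (J (e p))
  have c3 := hS.bianchi (J (e k)) (J (e p)) ((e r)) (e r) (J (e r))
  have a4 := hS.bianchi (J (e k)) ((e p)) (J (e r)) (e k) (J (e k))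
  have b4 := hS.bianchi (J (e k)) ((e p)) (J (e r)) (e p) (J (e p))
  have c4 := hS.bianchi (J (e k)) ((e p)) (J (e r)) (e r) (J (e r))
  simp only [sw _ (e r) (e k), hS.symm _ (e r) (e k), sw _ (e r) (e p), hS.symm _ (e r) (e p),
    sw _ (e p) (e k), hS.symm _ (e p) (e k), inv, dphi, phi, h.left, h.sq, h.inv, hQ.left h, hA.midJ h, hA.self, hA.selfJ h, hε, he.eig, he.eig_right h hQ,
    s1, s2, he.norm, he.orth, he.orthJ, hkr, hkr.symm, hkp, hkp.symm, hpr, hpr.symm, Ap, Ar, hp, hr,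
    hQA, QA, self, map_neg, neg_neg, mul_zero, zero_mul, add_zero, zero_add, sub_zero, zero_sub,
    mul_neg, neg_mul, neg_zero, mul_one, one_mul, ne_eq, not_false_eq_true, zero_apply, map_zero] 
    at a1 b1 c1 a2 b2 c2 a3 b3 c3 a4 b4 c4
  have hs := hA.skew (e k) (e p) (e r)
  rw [hs]
  clear sw self inv QA hQA
  linarith

end HermitianAlgebra

/-! ### The alternative `Q = 0` or `A = 0` in an eigenframe. -/

namespace HermitianAlgebra

open LocalGeometry

variable {E : Type*} [NormedAddCommGroup E] [NormedSpace ℝ E]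
variable {ι : Type*} {g : E →L[ℝ] E →L[ℝ] ℝ} {J : E →L[ℝ] E} {Q : E →ₗ[ℝ] E →ₗ[ℝ] ℝ}
  {q : ι → ℝ} {e : ι → E} {A : E →L[ℝ] E →L[ℝ] E}

/-- If some eigenvalue of `Q` is non-zero then `A` is complex linear in its first argument. -/
theorem IsCyclic.complexLinear [Fintype ι] (hι : 3 ≤ Fintype.card ι) (h : IsHermitian g J)
    (hQ : IsInvariantForm J Q) (hA : IsCyclic g J Q A) (he : IsFrame g J Q q e)
    (hc : IsComplete g J e) {i : ι} (hi : q i ≠ 0) (w z : E) : A (J w) z = J (A w z) := by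
  classical
  have hB := hA.minus h hQ
  set B := A + (ContinuousLinearMap.compL ℝ E E E J) ∘L (A ∘L J) with hBdef
  have hBw : ∀ w z, B w z = A w z + J (A (J w) z) := fun w z => by simp [hBdef]
  have hε : ∀ w z, B (J w) z = -J (B w z) := fun w z => by
    rw [hBw, hBw]; simp [h.sq]
  have H : ∀ k, B (e k) = 0 := fun k =>
    eq_zero_of_frame h hB hc fun p => apply_frame_eq_zero h hQ hB he hc fun e' he' _ r => by
      by_contra hF
      exact hi (eigenvalue_eq_zero_of_antilinear hι h hQ hB he' hε hF i)
  have HB : B = 0 := eq_zero_of_frame_left hc H fun k => by ext z; simp [hε, H]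
  have := hBw (J w) z
  rw [HB] at this
  simp only [zero_apply, h.sq, map_neg, neg_apply] at this
  rw [← sub_eq_zero, this]; abel

/-- If some eigenvalue is nonzero, it is `q k`, and it is the only one. The earlier lemmas, applied
contrapositively, then give `A (e j) = 0` for `j ≠ k` and `A w (e k) = 0`. So the image of `A` lies
in the kernel of `Q`, as `eigenvalue_mul_eq_zero` requires. -/
theorem eigenvalue_eq_zero_of_linear [Fintype ι] (hι : 3 ≤ Fintype.card ι) (h : IsHermitian g J)
    (hQ : IsInvariantForm J Q) (hA : IsCyclic g J Q A) {S : E → E →ₗ[ℝ] E →ₗ[ℝ] ℝ}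
    (hS : IsBianchi g J Q A S) (he : IsFrame g J Q q e) (hc : IsComplete g J e)
    (hε : ∀ w z, A (J w) z = J (A w z)) {k p r : ι} (hF : g (A (e k) (e p)) (e r) ≠ 0) :
    ∀ i, q i = 0 := by
  classical
  by_contra! hq
  obtain ⟨i, hi⟩ := hq
  have hne : ∀ j, j ≠ k → q j = 0 := fun j hj => eigenvalue_eq_zero_of_linear_of_ne hι h hQ hA he hε hF hj
  have hik : i = k := by by_contra hik; exact hi (hne i hik)
  subst hik
  have Aj : ∀ j, j ≠ i → A (e j) = 0 := fun j hj =>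
    eq_zero_of_frame h hA hc fun p => apply_frame_eq_zero h hQ hA he hc fun e' he' _ r => by
      by_contra hF
      exact hi (eigenvalue_eq_zero_of_linear_of_ne hι h hQ hA he' hε hF hj.symm)
  have Aii : A (e i) (e i) = 0 := apply_frame_eq_zero h hQ hA he hc fun e' he' _ r => by
    by_contra hF
    exact hi (eigenvalue_eq_zero_of_linear_of_self hι h hQ hA he' hε hF i)
  have Ai : ∀ w, A w (e i) = 0 := fun w => by
    have H : ∀ j, A (e j) (e i) = 0 := fun j => by
      rcases eq_or_ne j i with rfl | hj
      · exact Aii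
      · simp [Aj j hj]
    rw [hc w]
    simp [hε, H]
  have gA : ∀ a b, g (A a b) (e i) = 0 := fun a b => by rw [hA.skew, Ai]; simp
  have gAJ : ∀ a b, g (A a b) (J (e i)) = 0 := fun a b => by
    rw [← hA.midJ h, gA]
  have hQA : ∀ a b c, Q (A a b) c = 0 := fun a b c => by
    have H : ∀ j v, Q (A a v) (e j) = 0 := fun j v => by
      rw [he.eig_right h hQ]
      rcases eq_or_ne j i with rfl | hj
      · rw [gA, mul_zero]
      · rw [hne j hj, zero_mul]
    have HJ : ∀ j, Q (A a b) (J (e j)) = 0 := fun j => by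
      rw [← neg_eq_zero, ← hQ.left h, ← neg_eq_zero, ← LinearMap.neg_apply, ← map_neg, ← hA.anti, H]
    rw [hc c]
    simp [H, HJ]
  have hpr : p ≠ r := by rintro rfl; exact hF (hA.self _ _)
  have hip : i ≠ p := by rintro rfl; rw [Aii] at hF; simp at hF
  have hir : i ≠ r := by rintro rfl; exact hF (gA _ _)
  rcases mul_eq_zero.1 (eigenvalue_mul_eq_zero h hQ hA hS he hε hip hir hpr (hne p hip.symm)
    (hne r hir.symm) (Aj p hip.symm) (Aj r hir.symm) hQA) with h0 | h0
  · exact hi h0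
  · exact hF h0

theorem eigenvalue_eq_zero_or [Fintype ι] (hι : 3 ≤ Fintype.card ι) (h : IsHermitian g J)
    (hQ : IsInvariantForm J Q) (hA : IsCyclic g J Q A) {S : E → E →ₗ[ℝ] E →ₗ[ℝ] ℝ}
    (hS : IsBianchi g J Q A S) (he : IsFrame g J Q q e) (hc : IsComplete g J e) :
    (∀ i, q i = 0) ∨ A = 0 := by
  classical
  refine or_iff_not_imp_left.2 fun hq => ?_
  push Not at hq
  obtain ⟨i, hi⟩ := hq
  have hε := hA.complexLinear hι h hQ he hc hi
  have H : ∀ k, A (e k) = 0 := fun k =>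
    eq_zero_of_frame h hA hc fun p => apply_frame_eq_zero h hQ hA he hc fun e' he' hc' r => by
      by_contra hF
      exact hi (eigenvalue_eq_zero_of_linear hι h hQ hA hS he' hc' hε hF i)
  exact eq_zero_of_frame_left hc H fun k => by ext z; simp [hε, H]

end HermitianAlgebra

/-! ### Existence of unitary eigenframes and the pointwise theorem. -/

namespace HermitianAlgebra

open LocalGeometry

/-- A complex structure `J` makes a real vector space a complex one. -/
@[reducible] def complexModule {V : Type*} [AddCommGroup V] [Module ℝ V] (J : V →ₗ[ℝ] V)
    (sq : ∀ x, J (J x) = -x) : Module ℂ V where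
  smul c v := c.re • v + c.im • J v
  one_smul v := by
    change (1 : ℂ).re • v + (1 : ℂ).im • J v = v
    simp
  mul_smul a b v := by
    change (a * b).re • v + (a * b).im • J v
      = a.re • (b.re • v + b.im • J v) + a.im • J (b.re • v + b.im • J v)
    simp only [Complex.mul_re, Complex.mul_im, map_add, map_smul, sq]
    module
  smul_zero a := by
    change a.re • (0 : V) + a.im • J 0 = 0
    simp
  smul_add a v w := by
    change a.re • (v + w) + a.im • J (v + w) = (a.re • v + a.im • J v) + (a.re • w + a.im • J w)
    rw [map_add]; module
  add_smul a b v := by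
    change (a + b).re • v + (a + b).im • J v = (a.re • v + a.im • J v) + (b.re • v + b.im • J v)
    simp only [Complex.add_re, Complex.add_im]; module
  zero_smul v := by
    change (0 : ℂ).re • v + (0 : ℂ).im • J v = 0
    simp

/-- This is the spectral theorem over `ℂ`: `J` supplies the complex structure, and the `g`-dual
endomorphism of `Q` commutes with `J` and is self-adjoint. The space `V` carries no norm, so the one
induced by `g` can be installed without a conflict of instances. -/
theorem exists_unitary_eigenbasis {V : Type*} [AddCommGroup V] [Module ℝ V] [FiniteDimensional ℝ V]
    (g Q : V →ₗ[ℝ] V →ₗ[ℝ] ℝ) (J : V →ₗ[ℝ] V) (symm : ∀ x y, g x y = g y x)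
    (pos : ∀ x, x ≠ 0 → 0 < g x x) (sq : ∀ x, J (J x) = -x) (inv : ∀ x y, g (J x) (J y) = g x y)
    (Qsymm : ∀ x y, Q x y = Q y x) (Qinv : ∀ x y, Q (J x) (J y) = Q x y) :
    ∃ (m : ℕ) (q : Fin m → ℝ) (e : Fin m → V), (∀ i, g (e i) (e i) = 1) ∧
      (∀ i j, i ≠ j → g (e i) (e j) = 0) ∧ (∀ i j, g (e i) (J (e j)) = 0) ∧
      (∀ i v, Q (e i) v = q i * g (e i) v) ∧
      ∀ v, v = ∑ i, (g v (e i) • e i + g v (J (e i)) • J (e i)) := by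
  have left : ∀ x y, g (J x) y = -g x (J y) := fun x y => by
    rw [← inv x (J y), sq]; simp
  have Qleft : ∀ x y, Q (J x) y = -Q x (J y) := fun x y => by
    rw [← Qinv x (J y), sq]; simp
  have self : ∀ x, g x (J x) = 0 := fun x => by
    have := left x x
    have h2 := symm x (J x)
    linarith
  have nondeg : ∀ x, (∀ y, g x y = 0) → x = 0 := fun x hx => by
    by_contra h0
    exact (pos x h0).ne' (hx x)
  have hg : Function.Injective g := by
    rw [injective_iff_map_eq_zero]
    exact fun x hx => nondeg x fun y => by rw [hx]; rfl
  let φ : V ≃ₗ[ℝ] Module.Dual ℝ V :=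
    LinearEquiv.ofInjectiveOfFinrankEq g hg (Subspace.dual_finrank_eq).symm
  have hφ : ∀ x y, g (φ.symm (Q x)) y = Q x y := fun x y => by
    have : φ (φ.symm (Q x)) = Q x := φ.apply_symm_apply _
    exact congrArg (fun f : Module.Dual ℝ V => f y) this
  have hφJ : ∀ x, φ.symm (Q (J x)) = J (φ.symm (Q x)) := fun x => by
    rw [← sub_eq_zero]
    refine nondeg _ fun y => ?_
    rw [map_sub, LinearMap.sub_apply, hφ, left, hφ, Qleft]; ring
  let _ : Module ℂ V := complexModule J sq
  have smul_def : ∀ (c : ℂ) (v : V), c • v = c.re • v + c.im • J v := fun _ _ => rfl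
  have _ : IsScalarTower ℝ ℂ V := ⟨fun r c v => by
    simp only [smul_def, Complex.smul_re, Complex.smul_im, smul_eq_mul]; module⟩
  have _ : FiniteDimensional ℂ V := Module.Finite.of_restrictScalars_finite ℝ ℂ V
  let core : InnerProductSpace.Core ℂ V :=
    -- The minus sign makes the product linear in the second and conjugate-linear in the first
    -- argument.
    { inner := fun x y => ⟨g x y, -g x (J y)⟩
      conj_inner_symm := fun x y => by
        apply Complex.ext
        · simp [symm]
        · have := left x y
          simp [symm y (J x), this]
      re_inner_nonneg := fun x => by
        by_cases h0 : x = 0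
        · simp [h0]
        · exact (pos x h0).le
      add_left := fun x y z => by
        apply Complex.ext <;> simp; ring
      smul_left := fun x y c => by
        apply Complex.ext <;> simp [smul_def, left, sq] <;> ring
      definite := fun x hx => by
        by_contra h0
        exact (pos x h0).ne' (congrArg Complex.re hx) }
  let _ : NormedAddCommGroup V := core.toNormedAddCommGroup
  let _ : InnerProductSpace ℂ V := InnerProductSpace.ofCore core.toCore
  have inner_def : ∀ x y : V, inner ℂ x y = ⟨g x y, -g x (J y)⟩ := fun _ _ => rfl
  let T : V →ₗ[ℂ] V :=
    { toFun := fun x => φ.symm (Q x)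
      map_add' := fun x y => by simp
      map_smul' := fun c x => by simp [smul_def, hφJ] }
  have T_def : ∀ x y, g (T x) y = Q x y := hφ
  have hT : T.IsSymmetric := fun x y => by
    rw [inner_def, inner_def]
    apply Complex.ext
    · simp only [T_def]; rw [symm, T_def, Qsymm]
    · simp only [T_def]
      have h1 := left x (T y)
      rw [symm, T_def, Qsymm, Qleft] at h1
      linarith
  let b := hT.eigenvectorBasis rfl
  have hb := b.orthonormal
  have hb' : ∀ i j, inner ℂ (b i) (b j) = if i = j then (1 : ℂ) else 0 := by
    classical
    intro i j
    convert (orthonormal_iff_ite.1 hb) i j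
  refine ⟨_, hT.eigenvalues rfl, b, fun i => ?_, fun i j hij => ?_, fun i j => ?_, fun i v => ?_,
    fun v => ?_⟩
  · have := congrArg Complex.re (hb' i i)
    rwa [inner_def, if_pos rfl] at this
  · simpa [inner_def, hij] using congrArg Complex.re (hb' i j)
  · have := congrArg Complex.im (hb' i j)
    by_cases hij : i = j
    · rw [hij]; exact self _
    · simpa [inner_def, hij] using this
  · rw [← T_def, hT.apply_eigenvectorBasis rfl i]
    simp [smul_def, b]
  · conv_lhs => rw [← b.sum_repr' v]
    refine Finset.sum_congr rfl fun i _ => ?_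
    rw [inner_def, smul_def]
    simp only
    rw [symm, ← left, symm (J _) v]

variable {E : Type*} [NormedAddCommGroup E] [NormedSpace ℝ E]

theorem exists_frame [FiniteDimensional ℝ E] {g : E →L[ℝ] E →L[ℝ] ℝ} {J : E →L[ℝ] E}
    {Q : E →ₗ[ℝ] E →ₗ[ℝ] ℝ} (h : IsHermitian g J) (hQ : IsInvariantForm J Q) :
    ∃ (m : ℕ) (q : Fin m → ℝ) (e : Fin m → E), IsFrame g J Q q e ∧ IsComplete g J e := by
  obtain ⟨m, q, e, h1, h2, h3, h4, h5⟩ := exists_unitary_eigenbasis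
    ((ContinuousLinearMap.coeLM ℝ).comp (g : E →ₗ[ℝ] E →L[ℝ] ℝ)) Q (J : E →ₗ[ℝ] E) h.symm h.pos h.sq
    h.inv hQ.symm hQ.inv
  exact ⟨m, q, e, ⟨h1, h2, h3, h4⟩, h5⟩

theorem IsComplete.finrank_le {g : E →L[ℝ] E →L[ℝ] ℝ} {J : E →L[ℝ] E} {ι : Type*} [Fintype ι]
    {e : ι → E} (hc : IsComplete g J e) : Module.finrank ℝ E ≤ 2 * Fintype.card ι := by
  have : Submodule.span ℝ (Set.range (Sum.elim e fun i => J (e i))) = ⊤ := by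
    refine eq_top_iff.2 fun v _ => ?_
    rw [hc v]
    refine Submodule.sum_mem _ fun i _ => Submodule.add_mem _ (Submodule.smul_mem _ _ ?_)
      (Submodule.smul_mem _ _ ?_)
    · exact Submodule.subset_span ⟨Sum.inl i, rfl⟩
    · exact Submodule.subset_span ⟨Sum.inr i, rfl⟩
  have h := finrank_range_le_card (R := ℝ) (Sum.elim e fun i => J (e i))
  rw [Set.finrank, this, finrank_top] at h
  simpa [two_mul] using h

/-- The pointwise form of the theorem: `Q` or `A` vanishes. -/
theorem form_eq_zero_or [FiniteDimensional ℝ E] (hdim : 5 ≤ Module.finrank ℝ E)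
    {g : E →L[ℝ] E →L[ℝ] ℝ} {J : E →L[ℝ] E}
    {Q : E →ₗ[ℝ] E →ₗ[ℝ] ℝ} {A : E →L[ℝ] E →L[ℝ] E} (h : IsHermitian g J)
    (hQ : IsInvariantForm J Q) (hA : IsCyclic g J Q A) {S : E → E →ₗ[ℝ] E →ₗ[ℝ] ℝ}
    (hS : IsBianchi g J Q A S) : Q = 0 ∨ A = 0 := by
  obtain ⟨m, q, e, he, hc⟩ := exists_frame h hQ
  have hm := hc.finrank_le
  -- From `5 ≤ finrank ≤ 2 * m` the frame has at least three members.
  refine (eigenvalue_eq_zero_or (by omega) h hQ hA hS he hc).imp_left fun hq => ?_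
  have H : ∀ i, Q (e i) = 0 := fun i => by ext v; simp [he.eig, hq]
  ext v w
  rw [hc v]
  simp [H, hQ.left h]

end HermitianAlgebra

/-! ### Levi-Civita calculus on an open subset of a vector space. -/

namespace LocalGeometry

open HermitianAlgebra

variable {E : Type*} [NormedAddCommGroup E] [NormedSpace ℝ E]

/-- A smooth almost Hermitian structure `(G, K)` on an open subset `U` of a vector space. -/
structure IsHermitianOn (G : E → E →L[ℝ] E →L[ℝ] ℝ) (K : E → E →L[ℝ] E) (U : Set E) : Prop where
  isOpen : IsOpen U
  contDiffOn_metric : ContDiffOn ℝ ∞ G U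
  contDiffOn_complex : ContDiffOn ℝ ∞ K U
  herm : ∀ y ∈ U, IsHermitian (G y) (K y)

theorem two_le_infty : (2 : WithTop ℕ∞) ≤ ∞ :=
  WithTop.coe_le_coe.2 (le_top : (2 : ℕ∞) ≤ ⊤)

/-- The derivative of `f` along the line through `y` with direction `w`. -/
theorem hasDerivAt_line {F : Type*} [NormedAddCommGroup F] [NormedSpace ℝ F] {f : E → F} {y : E}
    (hf : DifferentiableAt ℝ f y) (w : E) :
    HasDerivAt (fun t : ℝ => f (y + t • w)) (fderiv ℝ f y w) 0 := by
  have h1 : HasDerivAt (fun t : ℝ => y + t • w) w 0 := by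
    simpa using ((hasDerivAt_id (0 : ℝ)).smul_const w).const_add y
  have h2 : HasFDerivAt f (fderiv ℝ f y) (y + (0 : ℝ) • w) := by simpa using hf.hasFDerivAt
  exact h2.comp_hasDerivAt (0 : ℝ) h1

theorem eventually_line {U : Set E} (hU : IsOpen U) {y : E} (hy : y ∈ U) (w : E) :
    ∀ᶠ t : ℝ in nhds 0, y + t • w ∈ U := by
  have : Continuous fun t : ℝ => y + t • w := by fun_prop
  exact this.continuousAt.eventually_mem (by simpa using hU.mem_nhds hy)

/-- Two expressions that agree on an open set have the same derivative along lines. -/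
theorem deriv_line_unique {F : Type*} [NormedAddCommGroup F] [NormedSpace ℝ F] {U : Set E}
    (hU : IsOpen U) {y : E} (hy : y ∈ U) {w : E} {a b : E → F} (hab : ∀ y ∈ U, a y = b y) {a' b' : F}
    (ha : HasDerivAt (fun t : ℝ => a (y + t • w)) a' 0)
    (hb : HasDerivAt (fun t : ℝ => b (y + t • w)) b' 0) : a' = b' :=
  ha.unique (hb.congr_of_eventuallyEq ((eventually_line hU hy w).mono fun _ ht => hab _ ht))

namespace IsHermitianOn

variable {G : E → E →L[ℝ] E →L[ℝ] ℝ} {K : E → E →L[ℝ] E} {U : Set E}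

theorem contDiffAt_metric (h : IsHermitianOn G K U) {y : E} (hy : y ∈ U) : ContDiffAt ℝ ∞ G y :=
  h.contDiffOn_metric.contDiffAt (h.isOpen.mem_nhds hy)

theorem diff_metric (h : IsHermitianOn G K U) {y : E} (hy : y ∈ U) : DifferentiableAt ℝ G y :=
  (h.contDiffAt_metric hy).differentiableAt (by simp)

theorem diff_complex (h : IsHermitianOn G K U) {y : E} (hy : y ∈ U) : DifferentiableAt ℝ K y :=
  (h.contDiffOn_complex.contDiffAt (h.isOpen.mem_nhds hy)).differentiableAt (by simp)

theorem fderiv_symm (h : IsHermitianOn G K U) {y : E} (hy : y ∈ U) (w a b : E) :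
    fderiv ℝ G y w a b = fderiv ℝ G y w b a := by
  have h1 := hasDerivAt_line (h.diff_metric hy) w
  exact deriv_line_unique h.isOpen hy (a := fun y => G y a b) (b := fun y => G y b a)
    (fun z hz => (h.herm z hz).symm a b)
    (by simpa using (h1.clm_apply (hasDerivAt_const _ a)).clm_apply (hasDerivAt_const _ b))
    (by simpa using (h1.clm_apply (hasDerivAt_const _ b)).clm_apply (hasDerivAt_const _ a))


theorem contDiffOn_fderiv (h : IsHermitianOn G K U) : ContDiffOn ℝ ∞ (fderiv ℝ G) U :=
  h.contDiffOn_metric.fderiv_of_isOpen h.isOpen (by simp)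

variable [FiniteDimensional ℝ E]

theorem isInvertible (h : IsHermitianOn G K U) {y : E} (hy : y ∈ U) : (G y).IsInvertible := by
  have hinj : Function.Injective (G y : E →ₗ[ℝ] E →L[ℝ] ℝ) := by
    rw [injective_iff_map_eq_zero]
    intro x hx
    by_contra h0
    have := (h.herm y hy).pos x h0
    change G y x = 0 at hx
    rw [hx] at this
    simp at this
  have hrank : Module.finrank ℝ E = Module.finrank ℝ (E →L[ℝ] ℝ) := by
    rw [← (LinearMap.toContinuousLinearMap (𝕜 := ℝ) (E := E) (F' := ℝ)).finrank_eq]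
    exact Subspace.dual_finrank_eq.symm
  refine ⟨(LinearEquiv.ofInjectiveOfFinrankEq _ hinj hrank).toContinuousLinearEquiv, ?_⟩
  ext; rfl

/-- The Koszul formula. -/
theorem koszul (h : IsHermitianOn G K U) {y : E} (hy : y ∈ U) (x z w : E) :
    2 * G y (christoffel G y x z) w
      = fderiv ℝ G y x z w + fderiv ℝ G y z x w - fderiv ℝ G y w x z := by
  rw [christoffel_apply, map_smul, (h.isInvertible hy).self_apply_inverse]
  simp

theorem christoffel_symm (h : IsHermitianOn G K U) {y : E} (hy : y ∈ U) (x z : E) :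
    christoffel G y x z = christoffel G y z x := by
  refine (h.herm y hy).eq_of_inner fun w => ?_
  have h1 := h.koszul hy x z w
  have h2 := h.koszul hy z x w
  rw [h.fderiv_symm hy w x z] at h1
  linarith

/-- The Levi-Civita connection is metric. -/
theorem fderiv_metric (h : IsHermitianOn G K U) {y : E} (hy : y ∈ U) (w a b : E) :
    fderiv ℝ G y w a b = G y (christoffel G y w a) b + G y a (christoffel G y w b) := by
  have h1 := h.koszul hy w a b
  have h2 := h.koszul hy w b a
  rw [(h.herm y hy).symm] at h2
  rw [h.fderiv_symm hy a] at h1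
  rw [h.fderiv_symm hy w b, h.fderiv_symm hy b] at h2
  have h3 := h.fderiv_symm hy a b w
  have h4 := h.fderiv_symm hy b a w
  linarith

theorem contDiffOn_inverse (h : IsHermitianOn G K U) :
    ContDiffOn ℝ ∞ (fun y => (G y).inverse) U := fun y hy =>
  ((h.isInvertible hy).contDiffAt_map_inverse).comp_contDiffWithinAt y (h.contDiffOn_metric y hy)

theorem contDiffOn_christoffel (h : IsHermitianOn G K U) : ContDiffOn ℝ ∞ (christoffel G) U := by
  have h1 := h.contDiffOn_fderiv
  have h2 := h.contDiffOn_inverse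
  refine contDiffOn_clm_apply.2 fun x => contDiffOn_clm_apply.2 fun z => ?_
  simp only [christoffel_apply]
  refine contDiffOn_const.smul (h2.clm_apply ?_)
  refine contDiffOn_clm_apply.2 fun w => ?_
  simp only [sub_apply, add_apply,
    ContinuousLinearMap.flip_apply]
  have h3 : ∀ a b c, ContDiffOn ℝ ∞ (fun y => fderiv ℝ G y a b c) U := fun a b c =>
    ((h1.clm_apply contDiffOn_const).clm_apply contDiffOn_const).clm_apply contDiffOn_const
  exact ((h3 _ _ _).add (h3 _ _ _)).sub (h3 _ _ _)

theorem contDiffAt_christoffel (h : IsHermitianOn G K U) {y : E} (hy : y ∈ U) :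
    ContDiffAt ℝ ∞ (christoffel G) y :=
  h.contDiffOn_christoffel.contDiffAt (h.isOpen.mem_nhds hy)

theorem diff_christoffel (h : IsHermitianOn G K U) {y : E} (hy : y ∈ U) :
    DifferentiableAt ℝ (christoffel G) y :=
  (h.contDiffAt_christoffel hy).differentiableAt (by simp)

theorem contDiffOn_fderiv_christoffel (h : IsHermitianOn G K U) :
    ContDiffOn ℝ ∞ (fderiv ℝ (christoffel G)) U :=
  h.contDiffOn_christoffel.fderiv_of_isOpen h.isOpen (by simp)

theorem diff_fderiv_christoffel (h : IsHermitianOn G K U) {y : E} (hy : y ∈ U) :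
    DifferentiableAt ℝ (fderiv ℝ (christoffel G)) y :=
  (h.contDiffOn_fderiv_christoffel.contDiffAt (h.isOpen.mem_nhds hy)).differentiableAt (by simp)

end IsHermitianOn

/-- The curvature operator `R(x, z)` as a continuous linear map. -/
noncomputable def curvatureOp (G : E → E →L[ℝ] E →L[ℝ] ℝ) (x z y : E) : E →L[ℝ] E :=
  fderiv ℝ (christoffel G) y x z - fderiv ℝ (christoffel G) y z x
    + christoffel G y x ∘L christoffel G y z - christoffel G y z ∘L christoffel G y x

theorem curvatureOp_apply (G : E → E →L[ℝ] E →L[ℝ] ℝ) (x z y w : E) :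
    curvatureOp G x z y w = curvature G y x z w := rfl

namespace IsHermitianOn

variable {G : E → E →L[ℝ] E →L[ℝ] ℝ} {K : E → E →L[ℝ] E} {U : Set E} [FiniteDimensional ℝ E]

theorem contDiffOn_curvatureOp (h : IsHermitianOn G K U) (x z : E) :
    ContDiffOn ℝ ∞ (curvatureOp G x z) U := by
  have h1 := h.contDiffOn_fderiv_christoffel
  have h2 := h.contDiffOn_christoffel
  have h3 : ∀ a b, ContDiffOn ℝ ∞ (fun y => fderiv ℝ (christoffel G) y a b) U := fun a b =>
    (h1.clm_apply contDiffOn_const).clm_apply contDiffOn_const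
  have h4 : ∀ a, ContDiffOn ℝ ∞ (fun y => christoffel G y a) U := fun a =>
    h2.clm_apply contDiffOn_const
  exact (((h3 x z).sub (h3 z x)).add ((h4 x).clm_comp (h4 z))).sub ((h4 z).clm_comp (h4 x))

theorem diff_curvatureOp (h : IsHermitianOn G K U) (x z : E) {y : E} (hy : y ∈ U) :
    DifferentiableAt ℝ (curvatureOp G x z) y :=
  ((h.contDiffOn_curvatureOp x z).contDiffAt (h.isOpen.mem_nhds hy)).differentiableAt (by simp)

theorem fderiv_curvatureOp (h : IsHermitianOn G K U) {y : E} (hy : y ∈ U) (w x z : E) :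
    fderiv ℝ (curvatureOp G x z) y w
      = fderiv ℝ (fderiv ℝ (christoffel G)) y w x z - fderiv ℝ (fderiv ℝ (christoffel G)) y w z x
        + (fderiv ℝ (christoffel G) y w x ∘L christoffel G y z
            + christoffel G y x ∘L fderiv ℝ (christoffel G) y w z)
        - (fderiv ℝ (christoffel G) y w z ∘L christoffel G y x
            + christoffel G y z ∘L fderiv ℝ (christoffel G) y w x) := by
  have h1 := hasDerivAt_line (h.diff_fderiv_christoffel hy) w
  have h2 := hasDerivAt_line (h.diff_christoffel hy) w
  have h3 : ∀ a b, HasDerivAt (fun t : ℝ => fderiv ℝ (christoffel G) (y + t • w) a b)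
      (fderiv ℝ (fderiv ℝ (christoffel G)) y w a b) 0 := fun a b => by
    simpa using (h1.clm_apply (hasDerivAt_const _ a)).clm_apply (hasDerivAt_const _ b)
  have h4 : ∀ a, HasDerivAt (fun t : ℝ => christoffel G (y + t • w) a)
      (fderiv ℝ (christoffel G) y w a) 0 := fun a => by
    simpa using h2.clm_apply (hasDerivAt_const _ a)
  have h5 := (((h3 x z).sub (h3 z x)).add ((h4 x).clm_comp (h4 z))).sub ((h4 z).clm_comp (h4 x))
  simp only [zero_smul, add_zero] at h5
  exact (hasDerivAt_line (h.diff_curvatureOp x z hy) w).unique h5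

/-- The covariant derivative of the curvature operators, up to the terms in which the connection
acts on the arguments `x`, `z`. -/
noncomputable def _root_.LocalGeometry.nablaCurvature (G : E → E →L[ℝ] E →L[ℝ] ℝ) (y w x z : E) :
    E →L[ℝ] E :=
  fderiv ℝ (curvatureOp G x z) y w + christoffel G y w ∘L curvatureOp G x z y
    - curvatureOp G x z y ∘L christoffel G y w

/-- For constant fields `R(x, z) = [∇_x, ∇_z]`, and this is the Jacobi identity for `∇_w, ∇_x, ∇_z`.
Only the symmetry of second derivatives is needed. -/
theorem bianchi_second (h : IsHermitianOn G K U) {y : E} (hy : y ∈ U) (w x z : E) :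
    nablaCurvature G y w x z + nablaCurvature G y x z w + nablaCurvature G y z w x = 0 := by
  have hs : ∀ a b c, fderiv ℝ (fderiv ℝ (christoffel G)) y a b c
      = fderiv ℝ (fderiv ℝ (christoffel G)) y b a c := fun a b c =>
    congrArg (fun L : E →L[ℝ] E →L[ℝ] E => L c)
      ((h.contDiffAt_christoffel hy).isSymmSndFDerivAt (by simpa using two_le_infty) a b)
  simp only [nablaCurvature, h.fderiv_curvatureOp hy]
  rw [hs x w z, hs z w x, hs z x w]
  ext v
  simp only [curvatureOp, add_apply, sub_apply, ContinuousLinearMap.comp_apply, map_add, map_sub,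
    zero_apply]
  abel

/-- Torsion-freeness, used both for `christoffel` and, differentiated once, for its derivative. -/
theorem bianchi_first (h : IsHermitianOn G K U) {y : E} (hy : y ∈ U) (x z w : E) :
    curvature G y x z w + curvature G y z w x + curvature G y w x z = 0 := by
  have hs : ∀ v a b, fderiv ℝ (christoffel G) y v a b = fderiv ℝ (christoffel G) y v b a := by
    intro v a b
    have h1 := hasDerivAt_line (h.diff_christoffel hy) v
    exact deriv_line_unique h.isOpen hy (a := fun y => christoffel G y a b)
      (b := fun y => christoffel G y b a)
      (fun z hz => h.christoffel_symm hz a b)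
      (by simpa using (h1.clm_apply (hasDerivAt_const _ a)).clm_apply (hasDerivAt_const _ b))
      (by simpa using (h1.clm_apply (hasDerivAt_const _ b)).clm_apply (hasDerivAt_const _ a))
  simp only [curvature]
  rw [hs x z w, hs z x w, hs w z x, h.christoffel_symm hy z w, h.christoffel_symm hy x w,
    h.christoffel_symm hy z x]
  abel

end IsHermitianOn

end LocalGeometry

/-! ### Covariant derivatives of `J` and `Q`; symmetry of `Q` and the cyclic identity. -/

namespace LocalGeometry

open HermitianAlgebra

variable {E : Type*} [NormedAddCommGroup E] [NormedSpace ℝ E]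

/-- The linear form of a continuous bilinear map. -/
noncomputable def toBilin (B : E →L[ℝ] E →L[ℝ] ℝ) : E →ₗ[ℝ] E →ₗ[ℝ] ℝ :=
  ContinuousLinearMap.coeLM ℝ ∘ₗ (B : E →ₗ[ℝ] E →L[ℝ] ℝ)

@[simp] theorem toBilin_apply (B : E →L[ℝ] E →L[ℝ] ℝ) (x z : E) : toBilin B x z = B x z := rfl

/-- The covariant derivative `∇K` as a continuous bilinear map. -/
noncomputable def nablaOp (G : E → E →L[ℝ] E →L[ℝ] ℝ) (K : E → E →L[ℝ] E) (y : E) :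
    E →L[ℝ] E →L[ℝ] E :=
  fderiv ℝ K y + (ContinuousLinearMap.compL ℝ E E E).flip (K y) ∘L christoffel G y
    - ContinuousLinearMap.compL ℝ E E E (K y) ∘L christoffel G y

theorem nablaOp_apply (G : E → E →L[ℝ] E →L[ℝ] ℝ) (K : E → E →L[ℝ] E) (y x z : E) :
    nablaOp G K y x z = nablaEndo G K y x z := rfl

/-- The covariant derivative of a field of bilinear forms. -/
noncomputable def nablaForm (G Q : E → E →L[ℝ] E →L[ℝ] ℝ) (y w : E) : E →L[ℝ] E →L[ℝ] ℝ :=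
  fderiv ℝ Q y w - Q y ∘L christoffel G y w
    - (ContinuousLinearMap.compL ℝ E E ℝ).flip (christoffel G y w) ∘L Q y

theorem nablaForm_apply (G Q : E → E →L[ℝ] E →L[ℝ] ℝ) (y w a b : E) :
    nablaForm G Q y w a b
      = fderiv ℝ Q y w a b - Q y (christoffel G y w a) b - Q y a (christoffel G y w b) := rfl

theorem curvature_swap (G : E → E →L[ℝ] E →L[ℝ] ℝ) (y x z w : E) :
    curvature G y z x w = -curvature G y x z w := by
  simp only [curvature]; abel

namespace IsHermitianOn

variable {G : E → E →L[ℝ] E →L[ℝ] ℝ} {K : E → E →L[ℝ] E} {U : Set E}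

theorem nablaEndo_anti (h : IsHermitianOn G K U) {y : E} (hy : y ∈ U) (w z : E) :
    nablaEndo G K y w (K y z) = -K y (nablaEndo G K y w z) := by
  have h1 := hasDerivAt_line (h.diff_complex hy) w
  have h2 : HasDerivAt (fun t : ℝ => K (y + t • w) z) (fderiv ℝ K y w z) 0 := by
    simpa using h1.clm_apply (hasDerivAt_const _ z)
  have h3 : fderiv ℝ K y w (K y z) + K y (fderiv ℝ K y w z) = 0 :=
    deriv_line_unique h.isOpen hy (a := fun y => K y (K y z)) (b := fun _ => -z)
      (fun v hv => (h.herm v hv).sq z) (by simpa using h1.clm_apply h2) (hasDerivAt_const _ _)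
  simp only [nablaEndo, map_add, map_sub, (h.herm y hy).sq, map_neg]
  rw [eq_neg_of_add_eq_zero_left h3]
  abel

variable [FiniteDimensional ℝ E]

/-- The covariant derivative of `g(Jz, u) + g(z, Ju) = 0`. -/
theorem nablaEndo_skew (h : IsHermitianOn G K U) {y : E} (hy : y ∈ U) (w z u : E) :
    G y (nablaEndo G K y w z) u = -G y (nablaEndo G K y w u) z := by
  have hK := hasDerivAt_line (h.diff_complex hy) w
  have hG := hasDerivAt_line (h.diff_metric hy) w
  have h2 : ∀ z, HasDerivAt (fun t : ℝ => K (y + t • w) z) (fderiv ℝ K y w z) 0 := fun z => by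
    simpa using hK.clm_apply (hasDerivAt_const _ z)
  have h3 : fderiv ℝ G y w (K y z) u + G y (fderiv ℝ K y w z) u
      + (fderiv ℝ G y w z (K y u) + G y z (fderiv ℝ K y w u)) = 0 := by
    refine deriv_line_unique h.isOpen hy (a := fun y => G y (K y z) u + G y z (K y u))
      (b := fun _ => (0 : ℝ)) (w := w) (fun v hv => by rw [(h.herm v hv).left]; ring) ?_
      (hasDerivAt_const _ _)
    simpa using ((hG.clm_apply (h2 z)).clm_apply (hasDerivAt_const _ u)).fun_add
      ((hG.clm_apply (hasDerivAt_const _ z)).clm_apply (h2 u))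
  rw [h.fderiv_metric hy, h.fderiv_metric hy] at h3
  rw [(h.herm y hy).symm (nablaEndo G K y w u)]
  have e1 := (h.herm y hy).left (christoffel G y w z) u
  have e2 := (h.herm y hy).left z (christoffel G y w u)
  simp only [nablaEndo, map_add, map_sub, add_apply, sub_apply]
  linarith

end IsHermitianOn

/-- The curvature of the local almost Hermitian structure `(G, K)` is `φ(Q)`. -/
structure IsBochnerFlatOn (G : E → E →L[ℝ] E →L[ℝ] ℝ) (K : E → E →L[ℝ] E)
    (Q : E → E →L[ℝ] E →L[ℝ] ℝ) (U : Set E) : Prop extends IsHermitianOn G K U where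
  contDiffOn_form : ContDiffOn ℝ ∞ Q U
  curvature_eq : ∀ y ∈ U, ∀ x z w u,
    G y (curvature G y x z w) u = phi (G y) (K y) (fun a b => toBilin (Q y) a b) x z w u

namespace IsBochnerFlatOn

variable {G : E → E →L[ℝ] E →L[ℝ] ℝ} {K : E → E →L[ℝ] E} {Q : E → E →L[ℝ] E →L[ℝ] ℝ} {U : Set E}

theorem diff_form (h : IsBochnerFlatOn G K Q U) {y : E} (hy : y ∈ U) : DifferentiableAt ℝ Q y :=
  (h.contDiffOn_form.contDiffAt (h.isOpen.mem_nhds hy)).differentiableAt (by simp)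

/-- Evaluating `R(x, z) = -R(z, x)` on `(K x, x)` leaves `g(x, x)` times the required sum. -/
theorem form_swap (h : IsBochnerFlatOn G K Q U) {y : E} (hy : y ∈ U) (x z : E) :
    Q y x (K y z) = -Q y z (K y x) := by
  by_cases hx : x = 0
  · simp [hx]
  have h1 := h.curvature_eq y hy x z (K y x) x
  have h2 := h.curvature_eq y hy z x (K y x) x
  rw [curvature_swap] at h2
  have hH := h.herm y hy
  have hpos := hH.pos x hx
  simp only [phi, toBilin_apply, map_neg, hH.sq, hH.inv, neg_apply, hH.self] at h1 h2
  have e' := hH.swapJ x z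
  rw [e'] at h1
  have : G y x x * (Q y x (K y z) + Q y z (K y x)) = 0 := by linarith
  rcases mul_eq_zero.1 this with h0 | h0
  · exact absurd h0 hpos.ne'
  · linarith

variable [FiniteDimensional ℝ E]

/-- The first Bianchi identity for `x, a, b`, paired with `x`, where `x ≠ 0` is orthogonal to `a`
and `b`; such an `x` exists in dimension at least three. After `form_swap` only `g(x, x)` times the
antisymmetric part of `Q` remains. -/
theorem form_symm (h : IsBochnerFlatOn G K Q U) (hdim : 3 ≤ Module.finrank ℝ E) {y : E}
    (hy : y ∈ U) (a b : E) : Q y a b = Q y b a := by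
  have hH := h.herm y hy
  obtain ⟨x, hx, hx0⟩ : ∃ x : E, (G y x a = 0 ∧ G y x b = 0) ∧ x ≠ 0 := by
    let f : E →ₗ[ℝ] ℝ × ℝ := ((G y).flip a : E →ₗ[ℝ] ℝ).prod ((G y).flip b : E →ₗ[ℝ] ℝ)
    have hker : LinearMap.ker f ≠ ⊥ := LinearMap.ker_ne_bot_of_finrank_lt (by
      simp only [Module.finrank_prod, Module.finrank_self]; omega)
    obtain ⟨x, hx, hx0⟩ := Submodule.exists_mem_ne_zero_of_ne_bot hker
    exact ⟨x, Prod.mk_eq_zero.1 (LinearMap.mem_ker.1 hx), hx0⟩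
  have h1 := congrArg (fun v => G y v x) (h.bianchi_first hy x a b)
  simp only [map_add, add_apply, map_zero, zero_apply, h.curvature_eq y hy] at h1
  simp only [phi, toBilin_apply] at h1
  rw [hH.symm x a] at hx
  rw [h.form_swap hy b a, h.form_swap hy a x, h.form_swap hy b x, h.form_swap hy x x,
    hH.symm b x, hH.symm b a, hH.symm x a, hH.swapJ b a, hH.swapJ a x, hH.swapJ b x, hx.1, hx.2,
    hH.self] at h1
  have : G y x x * (Q y a b - Q y b a) = 0 := by linear_combination h1
  rcases mul_eq_zero.1 this with h0 | h0
  · exact absurd h0 (hH.pos x hx0).ne'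
  · linarith

theorem isInvariantForm (h : IsBochnerFlatOn G K Q U) (hdim : 3 ≤ Module.finrank ℝ E) {y : E}
    (hy : y ∈ U) : IsInvariantForm (K y) (toBilin (Q y)) where
  symm := h.form_symm hdim hy
  inv x z := by
    rw [toBilin_apply, toBilin_apply, h.form_swap hy, (h.herm y hy).sq, h.form_symm hdim hy]
    simp

theorem curvatureOp_comm (h : IsBochnerFlatOn G K Q U) (hdim : 3 ≤ Module.finrank ℝ E) {y : E}
    (hy : y ∈ U) (x z : E) : curvatureOp G x z y ∘L K y = K y ∘L curvatureOp G x z y := by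
  ext v
  refine (h.herm y hy).eq_of_inner fun u => ?_
  simp only [ContinuousLinearMap.comp_apply, curvatureOp_apply]
  rw [(h.herm y hy).left, h.curvature_eq y hy, h.curvature_eq y hy,
    phi_J_right (h.herm y hy) (h.isInvariantForm hdim hy)]

theorem fderiv_curvatureOp_comm (h : IsBochnerFlatOn G K Q U) (hdim : 3 ≤ Module.finrank ℝ E)
    {y : E} (hy : y ∈ U) (w x z v : E) :
    fderiv ℝ (curvatureOp G x z) y w (K y v) + curvatureOp G x z y (fderiv ℝ K y w v)
      = fderiv ℝ K y w (curvatureOp G x z y v) + K y (fderiv ℝ (curvatureOp G x z) y w v) := by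
  have hK := hasDerivAt_line (h.diff_complex hy) w
  have hF := hasDerivAt_line (h.diff_curvatureOp x z hy) w
  have := deriv_line_unique h.isOpen hy (a := fun y => curvatureOp G x z y ∘L K y)
    (b := fun y => K y ∘L curvatureOp G x z y) (fun u hu => h.curvatureOp_comm hdim hu x z)
    (hF.clm_comp hK) (hK.clm_comp hF)
  simpa using congrArg (fun L : E →L[ℝ] E => L v) this

/-- Differentiating `[R(x, z), J] = 0` expresses `[R(x, z), ∇_w J]` through `[J, ∇_w R(x, z)]`,
whose cyclic sum vanishes by the second Bianchi identity. Skewness of `∇_w J` turns the commutator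
into the two terms of each bracket. -/
theorem isCyclic (h : IsBochnerFlatOn G K Q U) (hdim : 3 ≤ Module.finrank ℝ E) {y : E}
    (hy : y ∈ U) : IsCyclic (G y) (K y) (toBilin (Q y)) (nablaOp G K y) where
  anti := h.nablaEndo_anti hy
  skew := h.nablaEndo_skew hy
  cyc w x z v u := by
    have hb := h.bianchi_second hy w x z
    have key : ∀ w x z, G y (curvature G y x z (nablaOp G K y w v)) u
        + G y (curvature G y x z v) (nablaOp G K y w u)
        = G y (K y (nablaCurvature G y w x z v) - nablaCurvature G y w x z (K y v)) u := by
      intro w x z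
      have c1 := h.fderiv_curvatureOp_comm hdim hy w x z v
      have c2 := fun v => congrArg (fun L : E →L[ℝ] E => L v) (h.curvatureOp_comm hdim hy x z)
      simp only [ContinuousLinearMap.comp_apply] at c2
      have s := h.nablaEndo_skew hy w u (curvature G y x z v)
      rw [(h.herm y hy).symm (curvature G y x z v), nablaOp_apply, nablaOp_apply, s,
        ← sub_eq_add_neg, ← sub_apply, ← map_sub]
      congr 2
      simp only [nablaEndo, nablaCurvature, ← curvatureOp_apply, add_apply, sub_apply, map_add,
        map_sub, ContinuousLinearMap.comp_apply, c2]
      rw [eq_sub_of_add_eq c1]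
      abel
    simp only [← h.curvature_eq y hy]
    rw [key w x z, key x z w, key z w x, ← add_apply, ← map_add, ← add_apply, ← map_add]
    have b1 := congrArg (fun L : E →L[ℝ] E => K y (L v)) hb
    have b2 := congrArg (fun L : E →L[ℝ] E => L (K y v)) hb
    simp only [add_apply, map_add, zero_apply, map_zero] at b1 b2
    rw [show ∀ a b c d e f : E, a - b + (c - d) + (e - f) = (a + c + e) - (b + d + f) from
      fun _ _ _ _ _ _ => by abel, b1, b2]
    simp

theorem nablaForm_inv (h : IsBochnerFlatOn G K Q U) (hdim : 3 ≤ Module.finrank ℝ E) {y : E}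
    (hy : y ∈ U) (w a b : E) :
    nablaForm G Q y w (K y a) (K y b) + Q y (nablaEndo G K y w a) (K y b)
      + Q y (K y a) (nablaEndo G K y w b) = nablaForm G Q y w a b := by
  have hK := hasDerivAt_line (h.diff_complex hy) w
  have hQ := hasDerivAt_line (h.diff_form hy) w
  have h2 : ∀ z, HasDerivAt (fun t : ℝ => K (y + t • w) z) (fderiv ℝ K y w z) 0 := fun z => by
    simpa using hK.clm_apply (hasDerivAt_const _ z)
  have h3 := deriv_line_unique h.isOpen hy (a := fun y => Q y (K y a) (K y b))
    (b := fun y => Q y a b) (fun u hu => (h.isInvariantForm hdim hu).inv a b)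
    ((hQ.clm_apply (h2 a)).clm_apply (h2 b))
    ((hQ.clm_apply (hasDerivAt_const _ a)).clm_apply (hasDerivAt_const _ b))
  have i1 := (h.isInvariantForm hdim hy).inv (christoffel G y w a) b
  have i2 := (h.isInvariantForm hdim hy).inv a (christoffel G y w b)
  simp only [toBilin_apply] at i1 i2
  simp only [zero_smul, add_zero, add_apply, map_zero] at h3
  simp only [nablaForm_apply, nablaEndo, map_add, map_sub, add_apply, sub_apply]
  linarith

theorem nablaForm_symm (h : IsBochnerFlatOn G K Q U) (hdim : 3 ≤ Module.finrank ℝ E) {y : E}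
    (hy : y ∈ U) (w a b : E) : nablaForm G Q y w a b = nablaForm G Q y w b a := by
  have hQ := hasDerivAt_line (h.diff_form hy) w
  have h3 := deriv_line_unique h.isOpen hy (a := fun y => Q y a b)
    (b := fun y => Q y b a) (fun u hu => h.form_symm hdim hu a b)
    ((hQ.clm_apply (hasDerivAt_const _ a)).clm_apply (hasDerivAt_const _ b))
    ((hQ.clm_apply (hasDerivAt_const _ b)).clm_apply (hasDerivAt_const _ a))
  simp only [zero_smul, add_zero, map_zero] at h3
  rw [nablaForm_apply, nablaForm_apply, h3, h.form_symm hdim hy a, h.form_symm hdim hy _ b]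
  ring

end IsBochnerFlatOn

end LocalGeometry

/-! ### The Leibniz rule for `φ` and the Bianchi identity for `φ(Q)`. -/

namespace LocalGeometry

open HermitianAlgebra

variable {E : Type*} [NormedAddCommGroup E] [NormedSpace ℝ E]

theorem hasDerivAt_phi {g Q : ℝ → E →L[ℝ] E →L[ℝ] ℝ} {J : ℝ → E →L[ℝ] E}
    {g' Q' : E →L[ℝ] E →L[ℝ] ℝ} {J' : E →L[ℝ] E} {t : ℝ} (hg : HasDerivAt g g' t)
    (hJ : HasDerivAt J J' t) (hQ : HasDerivAt Q Q' t) (x y z u : E) :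
    HasDerivAt (fun t => phi (g t) (J t) (fun a b => Q t a b) x y z u)
      (phi g' (J t) (fun a b => Q t a b) x y z u + phi (g t) (J t) (fun a b => Q' a b) x y z u
        + dphi (g t) (J t) J' (fun a b => Q t a b) x y z u) t := by
  have hJv : ∀ v, HasDerivAt (fun t => J t v) (J' v) t := fun v => by
    simpa using hJ.clm_apply (hasDerivAt_const _ v)
  have h0 : ∀ {B : ℝ → E →L[ℝ] E →L[ℝ] ℝ} {B' : E →L[ℝ] E →L[ℝ] ℝ}, HasDerivAt B B' t →
      ∀ a b, HasDerivAt (fun t => B t a b) (B' a b) t := fun hB a b => by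
    simpa using (hB.clm_apply (hasDerivAt_const _ a)).clm_apply (hasDerivAt_const _ b)
  have h1 : ∀ {B : ℝ → E →L[ℝ] E →L[ℝ] ℝ} {B' : E →L[ℝ] E →L[ℝ] ℝ}, HasDerivAt B B' t →
      ∀ a b, HasDerivAt (fun t => B t a (J t b)) (B' a (J t b) + B t a (J' b)) t := fun hB a b => by
    simpa using (hB.clm_apply (hasDerivAt_const _ a)).clm_apply (hJv b)
  have p0 : ∀ a b c d, HasDerivAt (fun t => g t a b * Q t c d)
      (g' a b * Q t c d + g t a b * Q' c d) t := fun a b c d => (h0 hg a b).fun_mul (h0 hQ c d)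
  have p1 : ∀ a b c d, HasDerivAt (fun t => g t a (J t b) * Q t c (J t d))
      ((g' a (J t b) + g t a (J' b)) * Q t c (J t d)
        + g t a (J t b) * (Q' c (J t d) + Q t c (J' d))) t := fun a b c d =>
    (h1 hg a b).fun_mul (h1 hQ c d)
  have key := ((((((((((p0 x u y z).fun_sub (p0 x z y u)).fun_add (p0 y z x u)).fun_sub
    (p0 y u x z)).fun_add (p1 x u y z)).fun_sub (p1 x z y u)).fun_sub
    ((p1 x y z u).const_mul 2)).fun_add (p1 y z x u)).fun_sub (p1 y u x z)).fun_sub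
    ((p1 z u x y).const_mul 2))
  refine (key.congr_of_eventuallyEq (.of_forall fun s => ?_)).congr_deriv ?_
  · simp only [phi]; ring
  · simp only [phi, dphi]; ring

/-- The Leibniz rule for `φ`. -/
theorem phi_leibniz {g Q g' Q' S : E →L[ℝ] E →L[ℝ] ℝ} {J J' A Γ : E →L[ℝ] E}
    (hg : ∀ a b, g' a b = g (Γ a) b + g a (Γ b)) (hQ : ∀ a b, S a b = Q' a b - Q (Γ a) b - Q a (Γ b))
    (hJ : ∀ a, A a = J' a + Γ (J a) - J (Γ a)) (x y z u : E) :
    phi g' J (fun a b => Q a b) x y z u + phi g J (fun a b => Q' a b) x y z u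
        + dphi g J J' (fun a b => Q a b) x y z u
      = phi g J (fun a b => S a b) x y z u + dphi g J A (fun a b => Q a b) x y z u
        + phi g J (fun a b => Q a b) (Γ x) y z u + phi g J (fun a b => Q a b) x (Γ y) z u
        + phi g J (fun a b => Q a b) x y (Γ z) u + phi g J (fun a b => Q a b) x y z (Γ u) := by
  simp only [phi, dphi, hg, hQ, hJ, map_add, map_sub]
  ring

namespace IsBochnerFlatOn

variable {G : E → E →L[ℝ] E →L[ℝ] ℝ} {K : E → E →L[ℝ] E} {Q : E → E →L[ℝ] E →L[ℝ] ℝ} {U : Set E}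
variable [FiniteDimensional ℝ E]

/-- The derivative of `R = φ(Q)` along `w`. The last two terms are the action of the connection on
`x` and `z`, which `nablaCurvature` leaves out. -/
theorem inner_nablaCurvature (h : IsBochnerFlatOn G K Q U) {y : E} (hy : y ∈ U) (w x z v u : E) :
    G y (nablaCurvature G y w x z v) u
      = phi (G y) (K y) (fun a b => nablaForm G Q y w a b) x z v u
        + dphi (G y) (K y) (nablaOp G K y w) (fun a b => Q y a b) x z v u
        + G y (curvature G y (christoffel G y w x) z v) u
        + G y (curvature G y x (christoffel G y w z) v) u := by
  have hG := hasDerivAt_line (h.diff_metric hy) w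
  have hK := hasDerivAt_line (h.diff_complex hy) w
  have hQ := hasDerivAt_line (h.diff_form hy) w
  have hF := hasDerivAt_line (h.diff_curvatureOp x z hy) w
  have hv : HasDerivAt (fun t : ℝ => curvatureOp G x z (y + t • w) v)
      (fderiv ℝ (curvatureOp G x z) y w v) 0 := by
    simpa using hF.clm_apply (hasDerivAt_const _ v)
  have h3 := deriv_line_unique h.isOpen hy (w := w) (a := fun y => G y (curvatureOp G x z y v) u)
    (b := fun y => phi (G y) (K y) (fun a b => Q y a b) x z v u)
    (fun a ha => h.curvature_eq a ha x z v u)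
    ((hG.clm_apply hv).clm_apply (hasDerivAt_const _ u)) (hasDerivAt_phi hG hK hQ x z v u)
  simp only [zero_smul, add_zero, add_apply, map_zero] at h3
  rw [phi_leibniz (J' := fderiv ℝ K y w) (S := nablaForm G Q y w) (A := nablaOp G K y w)
    (Γ := christoffel G y w)
    (h.fderiv_metric hy w) (fun _ _ => rfl) (fun _ => rfl), h.fderiv_metric hy] at h3
  have e := h.curvature_eq y hy
  simp only [toBilin_apply] at e
  rw [← e, ← e, ← e, ← e] at h3
  simp only [nablaCurvature, curvatureOp_apply, add_apply, sub_apply, map_add, map_sub,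
    ContinuousLinearMap.comp_apply] at h3 ⊢
  linarith

theorem isBianchi (h : IsBochnerFlatOn G K Q U) (hdim : 3 ≤ Module.finrank ℝ E) {y : E}
    (hy : y ∈ U) : IsBianchi (G y) (K y) (toBilin (Q y)) (nablaOp G K y)
      (fun w => toBilin (nablaForm G Q y w)) where
  symm := h.nablaForm_symm hdim hy
  inv := h.nablaForm_inv hdim hy
  bianchi w x z v u := by
    have hb := congrArg (fun L : E →L[ℝ] E => G y (L v) u) (h.bianchi_second hy w x z)
    simp only [add_apply, map_add, zero_apply, map_zero] at hb
    rw [h.inner_nablaCurvature hy, h.inner_nablaCurvature hy, h.inner_nablaCurvature hy,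
      h.christoffel_symm hy x w, h.christoffel_symm hy z w, h.christoffel_symm hy z x] at hb
    -- After torsion-freeness has matched the connection terms, the six extra curvature terms cancel
    -- in pairs.
    have e1 := congrArg (fun a => G y a u) (curvature_swap G y x (christoffel G y w z) v)
    have e2 := congrArg (fun a => G y a u) (curvature_swap G y w (christoffel G y x z) v)
    have e3 := congrArg (fun a => G y a u) (curvature_swap G y z (christoffel G y w x) v)
    simp only [map_neg, neg_apply] at e1 e2 e3
    simp only [toBilin_apply]
    linarith

/-- A structure with curvature `φ(Q)` is flat at each point where it is not Kähler. -/
theorem curvature_eq_zero (h : IsBochnerFlatOn G K Q U) (hdim : 5 ≤ Module.finrank ℝ E) {y : E}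
    (hy : y ∈ U) (hne : ∃ x z, nablaEndo G K y x z ≠ 0) (x z w u : E) :
    curvatureTensor G y x z w u = 0 := by
  have hdim' : 3 ≤ Module.finrank ℝ E := by omega
  rcases form_eq_zero_or hdim (h.herm y hy) (h.isInvariantForm hdim' hy) (h.isCyclic hdim' hy)
    (h.isBianchi hdim' hy) with h0 | h0
  · rw [curvatureTensor, h.curvature_eq y hy, h0]
    simp [phi]
  · obtain ⟨a, b, hab⟩ := hne
    exact absurd (by rw [← nablaOp_apply, h0]; rfl) hab

end IsBochnerFlatOn

/-! ### Smoothness of the Ricci tensor, the scalar curvature and `Q`. -/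

theorem ricci_eq_sum [FiniteDimensional ℝ E] (G : E → E →L[ℝ] E →L[ℝ] ℝ) (y z w : E) :
    ricci G y z w = ∑ i, (Module.finBasis ℝ E).coord i
      (curvatureOp G (Module.finBasis ℝ E i) z y w) := by
  change LinearMap.trace ℝ E (curvatureEndo G y z w) = _
  rw [LinearMap.trace_eq_matrix_trace ℝ (Module.finBasis ℝ E), Matrix.trace]
  simp [LinearMap.toMatrix_apply, curvatureEndo, curvatureOp_apply]

namespace IsHermitianOn

variable {G : E → E →L[ℝ] E →L[ℝ] ℝ} {K : E → E →L[ℝ] E} {U : Set E}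
variable [FiniteDimensional ℝ E]

theorem contDiffOn_coord {f : E → E} (hf : ContDiffOn ℝ ∞ f U) (i) :
    ContDiffOn ℝ ∞ (fun y => (Module.finBasis ℝ E).coord i (f y)) U :=
  (LinearMap.toContinuousLinearMap ((Module.finBasis ℝ E).coord i)).contDiff.comp_contDiffOn hf

theorem contDiffOn_ricci (h : IsHermitianOn G K U) (z w : E) :
    ContDiffOn ℝ ∞ (fun y => ricci G y z w) U := by
  simp only [ricci_eq_sum]
  exact ContDiffOn.sum fun i _ => contDiffOn_coord
    ((h.contDiffOn_curvatureOp _ z).clm_apply contDiffOn_const) i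

theorem contDiffOn_scalarCurvature (h : IsHermitianOn G K U) :
    ContDiffOn ℝ ∞ (scalarCurvature G) U := by
  unfold scalarCurvature
  simp only [LinearMap.trace_eq_matrix_trace ℝ (Module.finBasis ℝ E), Matrix.trace, Matrix.diag,
    LinearMap.toMatrix_apply]
  refine ContDiffOn.sum fun i _ => contDiffOn_coord (f := fun y => (G y).inverse
    (LinearMap.toContinuousLinearMap (ricci G y (Module.finBasis ℝ E i))))
    (h.contDiffOn_inverse.clm_apply (contDiffOn_clm_apply.2 fun v => ?_)) i
  exact h.contDiffOn_ricci _ v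

/-- The tensor `Q` of a local almost Hermitian structure with vanishing Bochner tensor. -/
theorem isBochnerFlatOn (h : IsHermitianOn G K U) (n : ℕ)
    (hB : ∀ y ∈ U, ∀ x z w u, bochnerTensor n G K y x z w u = 0) :
    ∃ Q, IsBochnerFlatOn G K Q U := by
  let Q : E → E →L[ℝ] E →L[ℝ] ℝ := fun y =>
    (1 / (2 * ((n : ℝ) + 2))) • (ricci G y).toContinuousBilinearMap
      - (scalarCurvature G y / (8 * ((n : ℝ) + 1) * ((n : ℝ) + 2))) • G y
  refine ⟨Q, h, ?_, fun y hy x z w u => sub_eq_zero.1 (hB y hy x z w u)⟩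
  refine ContDiffOn.sub (ContDiffOn.const_smul _ ?_)
    ((h.contDiffOn_scalarCurvature.div_const _).smul h.contDiffOn_metric)
  exact contDiffOn_clm_apply.2 fun z => contDiffOn_clm_apply.2 fun w => h.contDiffOn_ricci z w

end IsHermitianOn

end LocalGeometry

/-! ### Behaviour of the connection and of `∇J` under local isometries. -/

namespace LocalGeometry

open HermitianAlgebra

variable {E : Type*} [NormedAddCommGroup E] [NormedSpace ℝ E]

/-- A local diffeomorphism `ψ` on `V` carrying `(G', K')` to `(G, K)`. -/
structure IsLocalIsometry (G G' : E → E →L[ℝ] E →L[ℝ] ℝ) (K K' : E → E →L[ℝ] E) (U U' V : Set E)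
    (ψ : E → E) : Prop where
  target : IsHermitianOn G K U
  source : IsHermitianOn G' K' U'
  isOpen : IsOpen V
  subset : V ⊆ U'
  mapsTo : Set.MapsTo ψ V U
  contDiffOn : ContDiffOn ℝ ∞ ψ V
  surjective : ∀ y ∈ V, Function.Surjective (fderiv ℝ ψ y)
  metric_eq : ∀ y ∈ V, ∀ a b, G' y a b = G (ψ y) (fderiv ℝ ψ y a) (fderiv ℝ ψ y b)
  complex_eq : ∀ y ∈ V, ∀ a, fderiv ℝ ψ y (K' y a) = K (ψ y) (fderiv ℝ ψ y a)

namespace IsLocalIsometry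

variable {G G' : E → E →L[ℝ] E →L[ℝ] ℝ} {K K' : E → E →L[ℝ] E} {U U' V : Set E} {ψ : E → E}

theorem diff (h : IsLocalIsometry G G' K K' U U' V ψ) {y : E} (hy : y ∈ V) :
    DifferentiableAt ℝ ψ y :=
  (h.contDiffOn.contDiffAt (h.isOpen.mem_nhds hy)).differentiableAt (by simp)

theorem hasDerivAt_comp (h : IsLocalIsometry G G' K K' U U' V ψ) {y : E} (hy : y ∈ V) (x : E)
    {F : Type*} [NormedAddCommGroup F] [NormedSpace ℝ F] {f : E → F}
    (hf : DifferentiableAt ℝ f (ψ y)) :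
    HasDerivAt (fun t : ℝ => f (ψ (y + t • x))) (fderiv ℝ f (ψ y) (fderiv ℝ ψ y x)) 0 := by
  have h1 := hasDerivAt_line (h.diff hy) x
  have h2 : HasFDerivAt f (fderiv ℝ f (ψ y)) (ψ (y + (0 : ℝ) • x)) := by simpa using hf.hasFDerivAt
  exact h2.comp_hasDerivAt (0 : ℝ) h1

theorem hasDerivAt_fderiv (h : IsLocalIsometry G G' K K' U U' V ψ) {y : E} (hy : y ∈ V) (x : E) :
    HasDerivAt (fun t : ℝ => fderiv ℝ ψ (y + t • x)) (fderiv ℝ (fderiv ℝ ψ) y x) 0 :=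
  hasDerivAt_line (((h.contDiffOn.fderiv_of_isOpen (m := ∞) h.isOpen (by simp)).contDiffAt
    (h.isOpen.mem_nhds hy)).differentiableAt (by simp)) x

theorem fderiv_metric_eq (h : IsLocalIsometry G G' K K' U U' V ψ) {y : E} (hy : y ∈ V)
    (x a b : E) :
    fderiv ℝ G' y x a b = fderiv ℝ G (ψ y) (fderiv ℝ ψ y x) (fderiv ℝ ψ y a) (fderiv ℝ ψ y b)
      + G (ψ y) (fderiv ℝ (fderiv ℝ ψ) y x a) (fderiv ℝ ψ y b)
      + G (ψ y) (fderiv ℝ ψ y a) (fderiv ℝ (fderiv ℝ ψ) y x b) := by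
  have hG' := hasDerivAt_line (h.source.diff_metric (h.subset hy)) x
  have hG := h.hasDerivAt_comp hy x (h.target.diff_metric (h.mapsTo hy))
  have hD : ∀ a, HasDerivAt (fun t : ℝ => fderiv ℝ ψ (y + t • x) a)
      (fderiv ℝ (fderiv ℝ ψ) y x a) 0 := fun a => by
    simpa using (h.hasDerivAt_fderiv hy x).clm_apply (hasDerivAt_const _ a)
  have := deriv_line_unique h.isOpen hy (a := fun y => G' y a b)
    (b := fun y => G (ψ y) (fderiv ℝ ψ y a) (fderiv ℝ ψ y b)) (fun z hz => h.metric_eq z hz a b)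
    ((hG'.clm_apply (hasDerivAt_const _ a)).clm_apply (hasDerivAt_const _ b))
    ((hG.clm_apply (hD a)).clm_apply (hD b))
  simpa using this

variable [FiniteDimensional ℝ E]

/-- The transformation rule of the Levi-Civita connection. -/
theorem fderiv_christoffel (h : IsLocalIsometry G G' K K' U U' V ψ) {y : E} (hy : y ∈ V)
    (x z : E) : fderiv ℝ ψ y (christoffel G' y x z)
      = christoffel G (ψ y) (fderiv ℝ ψ y x) (fderiv ℝ ψ y z)
        + fderiv ℝ (fderiv ℝ ψ) y x z := by
  have hs : ∀ a b, fderiv ℝ (fderiv ℝ ψ) y a b = fderiv ℝ (fderiv ℝ ψ) y b a := fun a b =>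
    (h.contDiffOn.contDiffAt (h.isOpen.mem_nhds hy)).isSymmSndFDerivAt (by simpa using two_le_infty)
      a b
  have hH := h.target.herm _ (h.mapsTo hy)
  refine hH.eq_of_inner fun u => ?_
  obtain ⟨w, rfl⟩ := h.surjective y hy u
  rw [← h.metric_eq y hy]
  have k' := h.source.koszul (h.subset hy) x z w
  have k := h.target.koszul (h.mapsTo hy) (fderiv ℝ ψ y x) (fderiv ℝ ψ y z) (fderiv ℝ ψ y w)
  rw [h.fderiv_metric_eq hy, h.fderiv_metric_eq hy, h.fderiv_metric_eq hy, hs w x, hs w z,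
    hs z x, hH.symm (fderiv ℝ ψ y z)] at k'
  simp only [map_add, add_apply]
  linarith

/-- Failure to be Kähler is witnessed in a single chart, while flatness is asserted in all of them,
so `∇J` has to be transported. The curvature does not, because the Bochner tensor is assumed to
vanish in every chart. The second derivatives of `ψ` from the connection cancel those from
differentiating `complex_eq`. -/
theorem fderiv_nablaEndo (h : IsLocalIsometry G G' K K' U U' V ψ) {y : E} (hy : y ∈ V)
    (x z : E) : fderiv ℝ ψ y (nablaEndo G' K' y x z)
      = nablaEndo G K (ψ y) (fderiv ℝ ψ y x) (fderiv ℝ ψ y z) := by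
  have hK' := hasDerivAt_line (h.source.diff_complex (h.subset hy)) x
  have hK := h.hasDerivAt_comp hy x (h.target.diff_complex (h.mapsTo hy))
  have hD := h.hasDerivAt_fderiv hy x
  have := deriv_line_unique h.isOpen hy (a := fun y => fderiv ℝ ψ y (K' y z))
    (b := fun y => K (ψ y) (fderiv ℝ ψ y z)) (fun v hv => h.complex_eq v hv z)
    (hD.clm_apply (hK'.clm_apply (hasDerivAt_const _ z)))
    (hK.clm_apply (hD.clm_apply (hasDerivAt_const _ z)))
  simp only [zero_smul, add_zero, map_zero] at this
  simp only [nablaEndo, map_add, map_sub, h.fderiv_christoffel hy, h.complex_eq y hy]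
  rw [eq_sub_of_add_eq' this]
  abel

end IsLocalIsometry

end LocalGeometry

/-! ### Charts of the manifold: smoothness of the components and transition maps. -/

namespace AlmostHermitian

open LocalGeometry HermitianAlgebra

variable {E : Type*} [NormedAddCommGroup E] [NormedSpace ℝ E]
  {M : Type*} [TopologicalSpace M] [ChartedSpace E M]
  {e e₀ : OpenPartialHomeomorph M E}

theorem mdifferentiable_of_mem_maximalAtlas (he : e ∈ IsManifold.maximalAtlas 𝓘(ℝ, E) ∞ M) :
    e.MDifferentiable 𝓘(ℝ, E) 𝓘(ℝ, E) :=
  ⟨(contMDiffOn_of_mem_maximalAtlas he).mdifferentiableOn (by simp),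
    (contMDiffOn_symm_of_mem_maximalAtlas he).mdifferentiableOn (by simp)⟩

/-- The differential of the chart `e` at `p`. -/
noncomputable def dChart (e : OpenPartialHomeomorph M E) (p : M) : E →L[ℝ] E :=
  mfderiv 𝓘(ℝ, E) 𝓘(ℝ, E) e p

/-- The differential of the inverse of the chart `e` at `y`. -/
noncomputable def dSymm (e : OpenPartialHomeomorph M E) (y : E) : E →L[ℝ] E :=
  mfderiv 𝓘(ℝ, E) 𝓘(ℝ, E) e.symm y

theorem dChart_dSymm (he : e ∈ IsManifold.maximalAtlas 𝓘(ℝ, E) ∞ M) {y : E} (hy : y ∈ e.target)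
    (v : E) : dChart e (e.symm y) (dSymm e y v) = v :=
  congrArg (fun L : E →L[ℝ] E => L v)
    ((mdifferentiable_of_mem_maximalAtlas he).comp_symm_deriv hy)

theorem dSymm_dChart' (he : e ∈ IsManifold.maximalAtlas 𝓘(ℝ, E) ∞ M) {p : M} (hp : p ∈ e.source)
    (v : E) : dSymm e (e p) (dChart e p v) = v :=
  congrArg (fun L : E →L[ℝ] E => L v)
    ((mdifferentiable_of_mem_maximalAtlas he).symm_comp_deriv hp)

theorem dSymm_dChart (he : e ∈ IsManifold.maximalAtlas 𝓘(ℝ, E) ∞ M) {y : E} (hy : y ∈ e.target)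
    (v : E) : dSymm e y (dChart e (e.symm y) v) = v := by
  have := dSymm_dChart' he (e.map_target hy) v
  rwa [e.right_inv hy] at this

variable [IsManifold 𝓘(ℝ, E) ∞ M]

/-- The metric at `p`, on the model space. -/
noncomputable def innerAt (A : AlmostHermitian E M) (p : M) : E →L[ℝ] E →L[ℝ] ℝ := A.metric.inner p

/-- The complex structure at `p`, on the model space. -/
noncomputable def complexAt (A : AlmostHermitian E M) (p : M) : E →L[ℝ] E := A.J p

theorem metricIn_apply (A : AlmostHermitian E M) (y a b : E) :
    A.metricIn e y a b = A.innerAt (e.symm y) (dSymm e y a) (dSymm e y b) := rfl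

theorem JIn_apply (A : AlmostHermitian E M) (y a : E) :
    A.JIn e y a = dChart e (e.symm y) (A.complexAt (e.symm y) (dSymm e y a)) := rfl

theorem isHermitian_at (A : AlmostHermitian E M) (p : M) :
    IsHermitian (A.innerAt p) (A.complexAt p) where
  symm := A.metric.symm p
  pos := A.metric.pos p
  sq := A.J_sq p
  inv := A.metric_J p

theorem isHermitian_in (A : AlmostHermitian E M) (he : e ∈ IsManifold.maximalAtlas 𝓘(ℝ, E) ∞ M)
    {y : E} (hy : y ∈ e.target) : IsHermitian (A.metricIn e y) (A.JIn e y) := by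
  have h := A.isHermitian_at (e.symm y)
  refine ⟨fun a b => ?_, fun a ha => ?_, fun a => ?_, fun a b => ?_⟩
  · simp only [metricIn_apply, h.symm]
  · rw [metricIn_apply]
    refine h.pos _ fun h0 => ha ?_
    rw [← dChart_dSymm he hy a, h0, map_zero]
  · simp only [JIn_apply, dSymm_dChart he hy, h.sq, map_neg, dChart_dSymm he hy]
  · simp only [metricIn_apply, JIn_apply, dSymm_dChart he hy, h.inv]

theorem metricIn_chart (A : AlmostHermitian E M) (he : e ∈ IsManifold.maximalAtlas 𝓘(ℝ, E) ∞ M)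
    {p : M} (hp : p ∈ e.source) (v w : E) :
    A.metricIn e (e p) (dChart e p v) (dChart e p w) = A.innerAt p v w := by
  rw [metricIn_apply, dSymm_dChart' he hp, dSymm_dChart' he hp, e.left_inv hp]

theorem JIn_chart (A : AlmostHermitian E M) (he : e ∈ IsManifold.maximalAtlas 𝓘(ℝ, E) ∞ M)
    {p : M} (hp : p ∈ e.source) (v : E) :
    A.JIn e (e p) (dChart e p v) = dChart e p (A.complexAt p v) := by
  rw [JIn_apply, dSymm_dChart' he hp, e.left_inv hp]

/-- Coordinate vector fields are smooth sections along `e.symm`; feeding them to the bundle sections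
`g` and `J` yields smooth components. -/
theorem contMDiffOn_dSymm (he : e ∈ IsManifold.maximalAtlas 𝓘(ℝ, E) ∞ M) (x : E) :
    ContMDiffOn 𝓘(ℝ, E) 𝓘(ℝ, E).tangent ∞
      (fun y => (TotalSpace.mk' E (e.symm y) (dSymm e y x) : TangentBundle 𝓘(ℝ, E) M)) e.target := by
  have h1 := (contMDiffOn_symm_of_mem_maximalAtlas he).contMDiffOn_tangentMapWithin (m := ∞)
    (by simp) e.open_target.uniqueMDiffOn
  have h2 : ContMDiff 𝓘(ℝ, E) 𝓘(ℝ, E).tangent ∞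
      (fun y : E => (⟨y, x⟩ : TangentBundle 𝓘(ℝ, E) E)) :=
    contMDiff_vectorSpace_iff_contDiff.2 contDiff_const
  refine (h1.comp h2.contMDiffOn (fun y hy => hy)).congr fun y hy => ?_
  simp only [Function.comp_apply, tangentMapWithin]
  rw [mfderivWithin_of_isOpen e.open_target hy]
  rfl

theorem contDiffOn_metricIn [FiniteDimensional ℝ E] (A : AlmostHermitian E M)
    (he : e ∈ IsManifold.maximalAtlas 𝓘(ℝ, E) ∞ M) : ContDiffOn ℝ ∞ (A.metricIn e) e.target := by
  refine contDiffOn_clm_apply.2 fun a => contDiffOn_clm_apply.2 fun b => ?_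
  rw [← contMDiffOn_iff_contDiffOn]
  have : ContMDiffOn 𝓘(ℝ, E) (𝓘(ℝ, E).prod 𝓘(ℝ)) ∞
      (fun y ↦ TotalSpace.mk' ℝ (E := Bundle.Trivial M ℝ) (e.symm y)
        (A.metric.inner (e.symm y) (dSymm e y a) (dSymm e y b))) e.target := by
    apply ContMDiffOn.clm_bundle_apply₂ (F₁ := E) (F₂ := E)
    · exact A.metric.contMDiff.comp_contMDiffOn (contMDiffOn_symm_of_mem_maximalAtlas he)
    · exact contMDiffOn_dSymm he a
    · exact contMDiffOn_dSymm he b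
  intro y hy
  have h2 := this y hy
  rw [contMDiffWithinAt_totalSpace] at h2
  exact h2.2

theorem contDiffOn_JIn [FiniteDimensional ℝ E] (A : AlmostHermitian E M)
    (he : e ∈ IsManifold.maximalAtlas 𝓘(ℝ, E) ∞ M) : ContDiffOn ℝ ∞ (A.JIn e) e.target := by
  refine contDiffOn_clm_apply.2 fun a => ?_
  have h1 : ContMDiffOn 𝓘(ℝ, E) 𝓘(ℝ, E).tangent ∞
      (fun y => (TotalSpace.mk' E (e.symm y) (A.J (e.symm y) (dSymm e y a)) :
        TangentBundle 𝓘(ℝ, E) M)) e.target := by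
    apply ContMDiffOn.clm_bundle_apply (F₁ := E) (F₂ := E)
    · exact A.J_contMDiff.comp_contMDiffOn (contMDiffOn_symm_of_mem_maximalAtlas he)
    · exact contMDiffOn_dSymm he a
  have h2 := (contMDiffOn_of_mem_maximalAtlas he).contMDiffOn_tangentMapWithin (m := ∞)
    (by simp) e.open_source.uniqueMDiffOn
  have h3 := (contMDiff_snd_tangentBundle_modelSpace (n := ∞) E 𝓘(ℝ, E)).comp_contMDiffOn
    (h2.comp h1 fun y hy => e.map_target hy)
  rw [← contMDiffOn_iff_contDiffOn]
  refine h3.congr fun y hy => ?_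
  exact congrArg (fun L : E →L[ℝ] E => L (A.J (e.symm y) (dSymm e y a)))
    (mfderivWithin_of_isOpen (I := 𝓘(ℝ, E)) (I' := 𝓘(ℝ, E)) (f := e) e.open_source
      (e.map_target hy)).symm

variable [FiniteDimensional ℝ E]

theorem isHermitianOn (A : AlmostHermitian E M) (he : e ∈ IsManifold.maximalAtlas 𝓘(ℝ, E) ∞ M) :
    IsHermitianOn (A.metricIn e) (A.JIn e) e.target :=
  ⟨e.open_target, A.contDiffOn_metricIn he, A.contDiffOn_JIn he, fun _ hy => A.isHermitian_in he hy⟩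

/-- Transition maps are local isometries between the structures in the two charts. -/
theorem isLocalIsometry (A : AlmostHermitian E M) (he : e ∈ IsManifold.maximalAtlas 𝓘(ℝ, E) ∞ M)
    (he₀ : e₀ ∈ IsManifold.maximalAtlas 𝓘(ℝ, E) ∞ M) :
    IsLocalIsometry (A.metricIn e₀) (A.metricIn e) (A.JIn e₀) (A.JIn e) e₀.target e.target
      (e.target ∩ e.symm ⁻¹' e₀.source) (e₀ ∘ e.symm) := by
  have hd : ∀ y ∈ e.target ∩ e.symm ⁻¹' e₀.source, ∀ v,
      fderiv ℝ (e₀ ∘ e.symm) y v = dChart e₀ (e.symm y) (dSymm e y v) := fun y hy v => by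
    rw [← mfderiv_eq_fderiv, mfderiv_comp y
      ((mdifferentiable_of_mem_maximalAtlas he₀).mdifferentiableAt hy.2)
      ((mdifferentiable_of_mem_maximalAtlas he).mdifferentiableAt_symm hy.1)]
    rfl
  refine ⟨A.isHermitianOn he₀, A.isHermitianOn he, e.symm.isOpen_inter_preimage e₀.open_source,
    Set.inter_subset_left, fun y hy => e₀.map_source hy.2, ?_, fun y hy u => ?_, fun y hy a b => ?_,
    fun y hy a => ?_⟩
  · rw [← contMDiffOn_iff_contDiffOn]
    exact (contMDiffOn_of_mem_maximalAtlas he₀).comp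
      ((contMDiffOn_symm_of_mem_maximalAtlas he).mono Set.inter_subset_left) fun y hy => hy.2
  · refine ⟨dChart e (e.symm y) (dSymm e₀ (e₀ (e.symm y)) u), ?_⟩
    rw [hd y hy, dSymm_dChart he hy.1]
    have := dChart_dSymm he₀ (e₀.map_source hy.2) u
    rwa [e₀.left_inv hy.2] at this
  · rw [hd y hy, hd y hy, Function.comp_apply, A.metricIn_chart he₀ hy.2, metricIn_apply]
  · rw [hd y hy, hd y hy, Function.comp_apply, A.JIn_chart he₀ hy.2, JIn_apply, dSymm_dChart he hy.1]

end AlmostHermitian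

/-! ### From the pointwise alternative to a flat neighbourhood. -/

theorem mainTheorem1 {E : Type*} [NormedAddCommGroup E] [NormedSpace ℝ E] [FiniteDimensional ℝ E]
    {M : Type*} [TopologicalSpace M] [ChartedSpace E M] [IsManifold 𝓘(ℝ, E) ∞ M]
    (n : ℕ) (hn : 2 < n) (hdim : Module.finrank ℝ E = 2 * n)
    (A : AlmostHermitian E M) (hB : A.BochnerVanishes n)
    (p : M) (hp : ¬ A.IsKahlerAt p) :
    ∃ U : Set M, IsOpen U ∧ p ∈ U ∧ A.IsFlatOn U := by
  simp only [AlmostHermitian.IsKahlerAt, not_forall] at hp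
  obtain ⟨e₀, he₀, hpe, x, z, hne⟩ := hp
  have h₀ := A.isHermitianOn he₀
  have hcont : ContinuousOn (fun y => LocalGeometry.nablaEndo (A.metricIn e₀) (A.JIn e₀) y x z) e₀.target := by
    have hK : ContinuousOn (fderiv ℝ (A.JIn e₀)) e₀.target :=
      (h₀.contDiffOn_complex.fderiv_of_isOpen (m := ∞) h₀.isOpen (by simp)).continuousOn
    have hΓ := h₀.contDiffOn_christoffel.continuousOn
    have hJ := h₀.contDiffOn_complex.continuousOn
    unfold LocalGeometry.nablaEndo
    fun_prop
  -- The neighbourhood is the set where the one component of `∇J` that is nonzero at `p`, read in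
  -- the chart `e₀`, stays nonzero.
  refine ⟨e₀.source ∩ e₀ ⁻¹' (e₀.target ∩ (fun y => LocalGeometry.nablaEndo (A.metricIn e₀) (A.JIn e₀) y x z) ⁻¹'
    {0}ᶜ), e₀.isOpen_inter_preimage (hcont.isOpen_inter_preimage e₀.open_target
    isOpen_compl_singleton), ⟨hpe, e₀.map_source hpe, hne⟩, ?_⟩
  rintro e he q hqe ⟨hq₀, -, hq⟩
  obtain ⟨Q, hQ⟩ := (A.isHermitianOn he).isBochnerFlatOn n (hB e he)
  refine hQ.curvature_eq_zero (by omega) (e.map_source hqe) ?_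
  have hI := A.isLocalIsometry he he₀
  have hmem : e q ∈ e.target ∩ e.symm ⁻¹' e₀.source :=
    ⟨e.map_source hqe, by rwa [Set.mem_preimage, e.left_inv hqe]⟩
  -- The vectors `x`, `z` of the chart `e₀` are pulled back to `e`, where the corresponding
  -- component of `∇J` must then be nonzero too.
  obtain ⟨a, rfl⟩ := hI.surjective _ hmem x
  obtain ⟨b, rfl⟩ := hI.surjective _ hmem z
  refine ⟨a, b, fun h0 => hq ?_⟩
  have := hI.fderiv_nablaEndo hmem a b
  rw [h0, map_zero, Function.comp_apply, e.left_inv hqe] at this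
  exact this.symm
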